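/- All trees are finite, and trees are counted up to isomorphism. A tree is homeomorphically irreducible if it has no vertex of degree $2$. A rooted tree is a tree with a distinguished vertex (the root); isomorphisms of rooted trees take root to root. In a rooted tree, a child of a vertex $v$ is a vertex adjacent to $v$ that is farther from the root than $v$. An $S$-tree is a rooted tree in which no vertex has exactly one child. Let $$t(x)=\sum_{n\ge 0}t_n x^n,\qquad s(x)=\sum_{n\ge 0}s_n x^n\in\mathbb{Q}[[x]],$$ where $t_n$ is the number of isomorphism classes of homeomorphically irreducible trees with $n$ vertices and $s_n$ is the number of isomorphism classes of $S$-trees with $n$ vertices (a tree has at least one vertex, so $t_0=s_0=0$). **Theorem.** As formal power series, $$t(x)=(1+x)\,s(x)+\tfrac12(1-x)\,s(x^2)-\tfrac12(1+x)\,s(x)^2 ,$$ and $s(x)$ satisfies $$s(x)=x\left(\exp\left(\sum_{k=1}^{\infty}\frac{s(x^k)}{k}\right)-s(x)\right),$$ where the infinite sum converges coefficientwise to a formal power series with zero constant term. -/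

import Mathlib

open PowerSeries
open scoped PowerSeries.WithPiTopology

/-- A graph is homeomorphically irreducible (series-reduced) if it has no vertex of degree `2`. -/
def SimpleGraph.IsHomeomorphicallyIrreducible {V : Type*} (G : SimpleGraph V)
    [G.LocallyFinite] : Prop :=
  ∀ v : V, G.degree v ≠ 2

/-- The children of a vertex `v` in the graph `G` rooted at `r`: the vertices adjacent to `v`
that are farther from the root than `v`. -/
def SimpleGraph.children {V : Type*} (G : SimpleGraph V) (r v : V) : Set V :=
  {w | G.Adj v w ∧ G.dist r v < G.dist r w}

/-- The graph `G` rooted at `r` is an `S`-tree: a rooted tree in which no vertex has exactly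
one child. -/
def SimpleGraph.IsSTree {V : Type*} (G : SimpleGraph V) (r : V) : Prop :=
  G.IsTree ∧ ∀ v : V, (G.children r v).ncard ≠ 1

open Classical in
/-- Homeomorphically irreducible trees with vertex set `Fin n`. Every tree with `n` vertices is
isomorphic to one with this vertex set. -/
def HITree (n : ℕ) : Type :=
  {G : SimpleGraph (Fin n) // G.IsTree ∧ G.IsHomeomorphicallyIrreducible}

/-- Isomorphism of homeomorphically irreducible trees. -/
instance HITree.isoSetoid (n : ℕ) : Setoid (HITree n) where
  r G H := Nonempty (G.1 ≃g H.1)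
  iseqv :=
    { refl := fun _ => ⟨SimpleGraph.Iso.refl⟩
      symm := fun ⟨f⟩ => ⟨f.symm⟩
      trans := fun ⟨f⟩ ⟨g⟩ => ⟨f.trans g⟩ }

/-- `S`-trees with vertex set `Fin n`, as pairs (tree, root). -/
def STree (n : ℕ) : Type :=
  {T : SimpleGraph (Fin n) × Fin n // T.1.IsSTree T.2}

/-- Isomorphism of `S`-trees: graph isomorphisms that take the root to the root. -/
instance STree.isoSetoid (n : ℕ) : Setoid (STree n) where
  r S T := ∃ f : S.1.1 ≃g T.1.1, f S.1.2 = T.1.2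
  iseqv :=
    { refl := fun _ => ⟨SimpleGraph.Iso.refl, rfl⟩
      symm := fun ⟨f, hf⟩ => ⟨f.symm, by rw [← hf]; exact f.symm_apply_apply _⟩
      trans := fun ⟨f, hf⟩ ⟨g, hg⟩ => ⟨f.trans g, by rw [← hg, ← hf]; rfl⟩ }

/-- The generating function of unlabeled homeomorphically irreducible trees by number of
vertices: the coefficient of `x ^ n` is the number of isomorphism classes of homeomorphically
irreducible trees with `n` vertices. -/
noncomputable def hiTreeGF : ℚ⟦X⟧ :=
  PowerSeries.mk fun n => (Nat.card (Quotient (HITree.isoSetoid n)) : ℚ)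

/-- The generating function of unlabeled `S`-trees by number of vertices: the coefficient of
`x ^ n` is the number of isomorphism classes of `S`-trees with `n` vertices. -/
noncomputable def sTreeGF : ℚ⟦X⟧ :=
  PowerSeries.mk fun n => (Nat.card (Quotient (STree.isoSetoid n)) : ℚ)

/-- The terms `f(x ^ k) / k`, for `k ≥ 1`. -/
noncomputable def expTerm (f : ℚ⟦X⟧) (k : ℕ+) : ℚ⟦X⟧ :=
  (1 / (k : ℚ)) • PowerSeries.expand (k : ℕ) k.ne_zero f

/-! Write s for the series of `S`-trees and M for the series of multisets of isomorphism classes of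
`S`-trees, weighted by total number of vertices. Cutting a tree at its root leaves the multiset of
its branches, which determines the rooted tree (`IsPlanted.branches_eq_iff`), and every multiset of
`S`-trees occurs (`exists_branches_eq`). The root of a branch has one neighbour fewer than in the
whole tree, so "not exactly one child" in the branch means "degree not 2" in the tree. Hence
`S`-trees correspond to multisets of size other than 1, giving s = x(M - s), and vertex-rooted
homeomorphically irreducible trees to multisets of size other than 2, with series v = x(M - (s² +
s(x²))/2). Euler's transform M = exp(Σ s(xᵏ)/k) is `weightGF_multisetWeight`: both sides satisfy the
same recursion.

Roots are removed by a dissimilarity argument. An automorphism of a tree satisfies: fixed vertices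
minus fixed edges plus reversed edges equals 1 (`IsTree.two_mul_card_fixed_add`). Summing this over
all labelled trees and all permutations fixing them, and applying a twisted Burnside lemma
(`MulAction.sum_sum_smul_eq_card_mul`), gives 2t + s² = 2v + s(x²). Here s² counts trees with an
oriented edge, that is, ordered pairs of `S`-trees (`HIDart.range_sides`), and s(x²) those whose
edge can be reversed. Eliminating M and v yields the formula for t. -/

namespace SimpleGraph

/-! ### Sides of an edge and automorphisms of a tree -/

variable {V : Type*} {G : SimpleGraph V}

/-- In a tree, exactly one neighbour of `u` is closer to a given vertex `w ≠ u`. -/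
theorem IsTree.existsUnique_adj_dist_lt (hG : G.IsTree) {u w : V} (h : u ≠ w) :
    ∃! v, G.Adj u v ∧ G.dist v w < G.dist u w := by
  have hc := hG.connected
  obtain ⟨p, hp⟩ := hc.exists_walk_length_eq_dist u w
  cases p with
  | nil => exact absurd rfl h
  | @cons _ v _ huv q =>
    simp only [Walk.length_cons] at hp
    have hq := dist_le q
    refine ⟨v, ⟨huv, by omega⟩, ?_⟩
    rintro v' ⟨huv', hv'⟩
    obtain ⟨q', hq'⟩ := hc.exists_walk_length_eq_dist v' w
    have h1 := huv'.diff_dist_adj (u := w)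
    rw [dist_comm (u := w) (v := v'), dist_comm (u := w) (v := u)] at h1
    -- Each closer neighbour starts a shortest path to `w`; paths in a tree are unique, so their
    -- second vertices agree.
    have e := (hG.isAcyclic.subsingleton_path u w).elim
      ⟨Walk.cons huv q, Walk.isPath_of_length_eq_dist _ (by simpa using hp)⟩
      ⟨Walk.cons huv' q', Walk.isPath_of_length_eq_dist _ (by simp only [Walk.length_cons]; omega)⟩
    have e' := congrArg Walk.snd (congrArg Subtype.val e)
    simpa using e'.symm

/-- The vertices on the `v`-side of the edge `uv`. -/
def side (G : SimpleGraph V) (u v : V) : Set V := {w | G.dist v w < G.dist u w}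

theorem mem_side {u v w : V} : w ∈ G.side u v ↔ G.dist v w < G.dist u w := Iff.rfl

theorem Adj.right_mem_side {u v : V} (h : G.Adj u v) : v ∈ G.side u v := by
  simp [mem_side, dist_eq_one_iff_adj.2 h]

theorem left_notMem_side {u v : V} : u ∉ G.side u v := by
  simp [mem_side]

theorem IsTree.compl_side (hG : G.IsTree) {u v : V} (h : G.Adj u v) :
    (G.side u v)ᶜ = G.side v u := by
  ext w
  have := hG.dist_ne_of_adj w h
  rw [dist_comm (v := u), dist_comm (v := v)] at this
  simp only [Set.mem_compl_iff, mem_side]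
  omega

theorem IsTree.notMem_side (hG : G.IsTree) {u v w : V} (h : G.Adj u v) :
    w ∉ G.side u v ↔ w ∈ G.side v u := by
  rw [← hG.compl_side h, Set.mem_compl_iff]

/-- Adjacent vertices have distances to a third one that differ by at most one. -/
theorem Adj.dist_le_succ (hc : G.Connected) {x y : V} (h : G.Adj x y) (w : V) :
    G.dist w x ≤ G.dist w y + 1 := by
  have := hc.dist_triangle (u := w) (v := y) (w := x)
  rwa [dist_eq_one_iff_adj.2 h.symm] at this

/-- The only edge between the two sides of an edge is the edge itself. -/
theorem IsTree.eq_of_adj_side (hG : G.IsTree) {u v x y : V} (h : G.Adj u v)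
    (hx : x ∈ G.side v u) (hy : y ∈ G.side u v) (hxy : G.Adj x y) : x = u ∧ y = v := by
  have hc := hG.connected
  rw [mem_side] at hx hy
  have h1 := h.dist_le_succ hc x
  have h2 := h.symm.dist_le_succ hc x
  have h3 := h.dist_le_succ hc y
  have h4 := h.symm.dist_le_succ hc y
  have h5 := hxy.dist_le_succ hc u
  have h6 := hxy.symm.dist_le_succ hc u
  have h7 := hxy.dist_le_succ hc v
  have h8 := hxy.symm.dist_le_succ hc v
  simp only [dist_comm (u := x), dist_comm (u := y)] at h1 h2 h3 h4
  -- Otherwise the first step `z` from `x` towards `u` is also closer to `v`, as is `y`. Uniqueness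
  -- forces `z = y`, although `y` is farther from `u` than `x`.
  have hxu : x = u := by
    by_contra hne
    obtain ⟨z, ⟨hz, hzd⟩, -⟩ := hG.existsUnique_adj_dist_lt hne
    have hxv : x ≠ v := by rintro rfl; simp at hx
    have h9 := h.symm.dist_le_succ hc z
    simp only [dist_comm (v := u), dist_comm (v := v)] at *
    have := (hG.existsUnique_adj_dist_lt hxv).unique (y₁ := z) (y₂ := y)
      ⟨hz, by simp only [dist_comm (v := v)]; omega⟩
      ⟨hxy, by simp only [dist_comm (v := v)]; omega⟩
    subst this
    omega
  refine ⟨hxu, ?_⟩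
  subst hxu
  simp only [dist_self] at *
  have : G.dist v y = 0 := by omega
  exact (hc.dist_eq_zero_iff.1 this).symm

/-- A set of vertices that is joined to its complement by a single edge is a side of this edge. -/
theorem IsTree.eq_side (hG : G.IsTree) {u v : V} {S : Set V} (hu : u ∉ S) (hv : v ∈ S)
    (hS : ∀ x y, x ∉ S → y ∈ S → G.Adj x y → x = u ∧ y = v) : S = G.side u v := by
  have hc := hG.connected
  -- Walking from a vertex of `S` towards `u` must leave `S`, which is possible only through `v`.
  -- Stated for all `S`, `u`, `v`, so that it also applies to the complement with the ends
  -- exchanged.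
  have key : ∀ (S : Set V) (u v : V), u ∉ S →
      (∀ x y, x ∉ S → y ∈ S → G.Adj x y → x = u ∧ y = v) →
      ∀ n w, G.dist w u = n → w ∈ S → G.dist v w < G.dist u w := by
    intro S u v hu hS n
    induction n with
    | zero =>
      intro w hw hwS
      rw [hc.dist_eq_zero_iff] at hw
      exact absurd (hw ▸ hwS) hu
    | succ n ih =>
      intro w hw hwS
      have hne : w ≠ u := by rintro rfl; exact hu hwS
      obtain ⟨z, ⟨hz, hzd⟩, -⟩ := hG.existsUnique_adj_dist_lt hne
      have h6 := hz.dist_le_succ hc u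
      simp only [dist_comm (u := u)] at h6
      by_cases hzS : z ∈ S
      · have := ih z (by omega) hzS
        have h7 := hz.dist_le_succ hc v
        rw [dist_comm (u := u)] at this ⊢
        omega
      · obtain ⟨rfl, rfl⟩ := hS z w hzS hwS hz.symm
        simp only [dist_self, dist_comm (u := z)]
        omega
  ext w
  constructor
  · exact key S u v hu hS _ w rfl
  · intro hw
    by_contra hwS
    have := key Sᶜ v u (by simpa using hv)
      (fun x y hx hy hxy => (hS y x hy (by simpa using hx) hxy.symm).symm) _ w rfl hwS
    rw [mem_side] at hw
    omega

theorem Iso.dist_eq {W : Type*} {H : SimpleGraph W} (f : G ≃g H) (hG : G.Connected) (x y : V) :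
    H.dist (f x) (f y) = G.dist x y := by
  apply le_antisymm
  · obtain ⟨p, hp⟩ := hG.exists_walk_length_eq_dist x y
    rw [← hp, ← Walk.length_map f.toHom p]
    exact dist_le _
  · obtain ⟨p, hp⟩ := ((Iso.connected_iff f).1 hG).exists_walk_length_eq_dist (f x) (f y)
    have := dist_le ((p.map f.symm.toHom).copy (f.symm_apply_apply x) (f.symm_apply_apply y))
    simpa [hp] using this

theorem Iso.mem_side_iff {W : Type*} {H : SimpleGraph W} (f : G ≃g H) (hG : G.Connected)
    {u v w : V} : f w ∈ H.side (f u) (f v) ↔ w ∈ G.side u v := by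
  simp only [mem_side, f.dist_eq hG]

open Finset in
open scoped Classical in
/-- For an automorphism of a tree, the number of fixed vertices, minus the number of fixed edges,
plus the number of reversed edges, is `1`. Edges are counted twice here, by their orientations. -/
theorem IsTree.two_mul_card_fixed_add [Fintype V] (hG : G.IsTree) (f : G ≃g G) :
    2 * (∑ v, if f v = v then 1 else 0)
        + (∑ u, ∑ v, if G.Adj u v ∧ f u = v ∧ f v = u then 1 else 0)
      = 2 + ∑ u, ∑ v, if G.Adj u v ∧ f u = u ∧ f v = v then 1 else 0 := by
  -- A moved vertex has exactly one neighbour in the direction of its image; a fixed vertex has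
  -- none.
  have hA : ∀ u, (∑ v, if G.Adj u v ∧ f u ∈ G.side u v then 1 else 0)
      + (if f u = u then 1 else 0) = 1 := by
    intro u
    by_cases hu : f u = u
    · simp [hu, left_notMem_side]
    · obtain ⟨w, hw, huniq⟩ := hG.existsUnique_adj_dist_lt (Ne.symm hu)
      rw [if_neg hu, add_zero, Finset.sum_eq_single w]
      · rw [if_pos]; exact hw
      · intro v _ hv
        rw [if_neg]
        exact fun h => hv (huniq v h)
      · simp
  -- On an edge, both ends point across it only if it is reversed, and neither does only if it is
  -- fixed; otherwise exactly one does.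
  have hB : ∀ u v, (if G.Adj u v ∧ f u ∈ G.side u v then 1 else 0)
      + (if G.Adj v u ∧ f v ∈ G.side v u then 1 else 0)
      + (if G.Adj u v ∧ f u = u ∧ f v = v then 1 else 0)
      = (if G.Adj u v then 1 else 0) + (if G.Adj u v ∧ f u = v ∧ f v = u then 1 else 0) := by
    intro u v
    by_cases h : G.Adj u v
    · have hf : G.Adj (f u) (f v) := f.map_adj_iff.2 h
      have hne := h.ne
      by_cases h1 : f u ∈ G.side u v <;> by_cases h2 : f v ∈ G.side v u
      · obtain ⟨e1, e2⟩ := hG.eq_of_adj_side h h2 h1 hf.symm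
        have h3 := h.right_mem_side
        have h4 := h.symm.right_mem_side
        simp [h, h.symm, e1, e2, hne, hne.symm, h3, h4]
      · have : ¬ (f u = u ∧ f v = v) := fun e => left_notMem_side (G := G) (e.1 ▸ h1)
        have h2' : ¬ (f u = v ∧ f v = u) := fun e => h2 (by rw [e.2]; exact h.symm.right_mem_side)
        simp [h, h.symm, h1, h2, this, h2']
      · have : ¬ (f u = u ∧ f v = v) := fun e => left_notMem_side (G := G) (e.2 ▸ h2)
        have h2' : ¬ (f u = v ∧ f v = u) := fun e => h1 (by rw [e.1]; exact h.right_mem_side)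
        simp [h, h.symm, h1, h2, this, h2']
      · rw [hG.notMem_side h] at h1
        rw [hG.notMem_side h.symm] at h2
        obtain ⟨e1, e2⟩ := hG.eq_of_adj_side h h1 h2 hf
        have h3 : u ∉ G.side u v := left_notMem_side
        have h4 : v ∉ G.side v u := left_notMem_side
        simp [h, h.symm, e1, e2, hne, h3, h4]
    · simp [h, G.adj_comm v u]
  have hE : (∑ u, ∑ v, if G.Adj u v then 1 else 0) + 2 = 2 * Fintype.card V := by
    have h1 := G.sum_degrees_eq_twice_card_edges
    have h2 := hG.card_edgeFinset
    have h3 : ∀ u, G.degree u = ∑ v, if G.Adj u v then 1 else 0 := by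
      intro u
      rw [Finset.sum_boole, ← G.card_neighborFinset_eq_degree]
      congr 1; ext; simp
    simp only [h3] at h1
    omega
  have hA' := Finset.sum_congr (rfl : (univ : Finset V) = univ) fun u _ => hA u
  have hB' := Finset.sum_congr (rfl : (univ : Finset V) = univ) fun u _ =>
    Finset.sum_congr (rfl : (univ : Finset V) = univ) fun v _ => hB u v
  simp only [sum_add_distrib] at hA' hB'
  rw [Finset.sum_comm (f := fun u v => if G.Adj v u ∧ f v ∈ G.side v u then 1 else 0)] at hB'
  simp only [sum_const, card_univ, smul_eq_mul, mul_one] at hA'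
  omega

end SimpleGraph

/-! ### Twisted Burnside lemma -/

open scoped Classical in
/-- A twisted form of Burnside's lemma. The orbits are described by a complete invariant `F`; the
pairs `(x, g)` with `g • x = τ x` count the orbits that are preserved by `τ`. -/
theorem MulAction.sum_sum_smul_eq_card_mul {Γ X β : Type*} [Group Γ] [Fintype Γ] [Fintype X]
    [DecidableEq X] [MulAction Γ X] (F : X → β) (hF : ∀ x y, F x = F y ↔ ∃ g : Γ, g • x = y) (τ : X → X)
    (φ : β → β) (hτ : ∀ x, F (τ x) = φ (F x)) :
    (∑ x, ∑ g : Γ, if g • x = τ x then 1 else 0)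
      = Nat.card {b // b ∈ Set.range F ∧ φ b = b} * Fintype.card Γ := by
  have hfib : ∀ b ∈ Finset.univ.image F,
      (∑ x with F x = b, ∑ g : Γ, if g • x = τ x then 1 else 0)
        = if φ b = b then Fintype.card Γ else 0 := by
    intro b hb
    obtain ⟨x₀, -, hx₀⟩ := Finset.mem_image.1 hb
    split_ifs with hφ
    -- With `h • x₀ = x` and `k • x = τ x`, the bijection `g ↦ k⁻¹ * g * h` removes the twist. Each
    -- group element then sends `x₀` to exactly one `x` of the orbit.
    · have h1 : ∀ x ∈ Finset.univ.filter (fun x => F x = b),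
          (∑ g : Γ, if g • x = τ x then 1 else 0) = ∑ g : Γ, if g • x₀ = x then 1 else 0 := by
        intro x hx
        have hx : F x = b := (Finset.mem_filter.1 hx).2
        obtain ⟨h, hh⟩ := (hF x₀ x).1 (hx₀.trans hx.symm)
        obtain ⟨k, hk⟩ := (hF x (τ x)).1 (by rw [hτ, hx, hφ])
        refine Fintype.sum_equiv ((Equiv.mulLeft k⁻¹).trans (Equiv.mulRight h)) _ _ fun g => ?_
        have : g • x = τ x ↔ (k⁻¹ * g * h) • x₀ = x := by
          rw [mul_smul, hh, mul_smul, inv_smul_eq_iff, hk]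
        exact if_congr this rfl rfl
      rw [Finset.sum_congr rfl h1, Finset.sum_comm]
      have h2 : ∀ g : Γ, (∑ x with F x = b, if g • x₀ = x then 1 else 0) = 1 := by
        intro g
        have : F (g • x₀) = b := by rw [← hx₀]; exact ((hF _ _).2 ⟨g, rfl⟩).symm
        simp [this]
      simp [h2]
    · refine Finset.sum_eq_zero fun x hx => Finset.sum_eq_zero fun g _ => if_neg fun hg => hφ ?_
      have hx : F x = b := (Finset.mem_filter.1 hx).2
      rw [← hx, ← hτ, ← hg]
      exact ((hF _ _).2 ⟨g, rfl⟩).symm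
  rw [← Finset.sum_fiberwise_of_maps_to (g := F) (t := Finset.univ.image F)
    (fun x _ => Finset.mem_image_of_mem _ (Finset.mem_univ x)), Finset.sum_congr rfl hfib,
    ← Finset.sum_filter, Finset.sum_const, smul_eq_mul]
  congr 1
  rw [← Nat.card_eq_finsetCard]
  exact Nat.card_congr (Equiv.subtypeEquivRight fun b => by simp)

/-! ### Relabelling of trees and the dissimilarity theorem -/

/-- `ncard` frees the condition from the choice of local finiteness instance. -/
theorem SimpleGraph.isHomeomorphicallyIrreducible_iff {V : Type*} (G : SimpleGraph V)
    [G.LocallyFinite] :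
    G.IsHomeomorphicallyIrreducible ↔ ∀ v, (G.neighborSet v).ncard ≠ 2 := by
  simp only [SimpleGraph.IsHomeomorphicallyIrreducible, ← G.card_neighborSet_eq_degree,
    ← Nat.card_coe_set_eq, Nat.card_eq_fintype_card]

theorem SimpleGraph.Iso.ncard_neighborSet {V W : Type*} {G : SimpleGraph V} {H : SimpleGraph W}
    (f : G ≃g H) (v : V) : (H.neighborSet (f v)).ncard = (G.neighborSet v).ncard := by
  rw [← Nat.card_coe_set_eq, ← Nat.card_coe_set_eq]
  exact (Nat.card_congr (f.mapNeighborSet v)).symm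

/-- The relabelling of a graph along a permutation. -/
def SimpleGraph.isoComapInv {V : Type*} (G : SimpleGraph V) (σ : Equiv.Perm V) :
    G ≃g G.comap ⇑σ⁻¹ where
  toEquiv := σ
  map_rel_iff' := by simp

namespace HITree

variable {n : ℕ}

/-- The underlying graph. -/
def graph (T : HITree n) : SimpleGraph (Fin n) := Subtype.val T

theorem graph_injective : Function.Injective (graph (n := n)) := Subtype.val_injective

theorem isTree (T : HITree n) : T.graph.IsTree := T.2.1

theorem ncard_neighborSet_ne (T : HITree n) (v : Fin n) : (T.graph.neighborSet v).ncard ≠ 2 := by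
  classical
  exact (T.graph.isHomeomorphicallyIrreducible_iff).1 T.2.2 v

/-- A homeomorphically irreducible tree from the condition on the sizes of neighbourhoods. -/
def ofNcard (G : SimpleGraph (Fin n)) (hG : G.IsTree) (h : ∀ v, (G.neighborSet v).ncard ≠ 2) :
    HITree n :=
  ⟨G, hG, by classical exact (G.isHomeomorphicallyIrreducible_iff).2 h⟩

instance : MulAction (Equiv.Perm (Fin n)) (HITree n) where
  smul σ T := ofNcard (T.graph.comap ⇑σ⁻¹) ((T.graph.isoComapInv σ).isTree_iff.1 T.isTree) fun v => by
    have := (T.graph.isoComapInv σ).ncard_neighborSet ((T.graph.isoComapInv σ).symm v)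
    rw [RelIso.apply_symm_apply] at this
    rw [this]
    exact T.ncard_neighborSet_ne _
  one_smul T := rfl
  mul_smul σ τ T := rfl

theorem smul_adj (σ : Equiv.Perm (Fin n)) (T : HITree n) (x y : Fin n) :
    (σ • T).graph.Adj x y ↔ T.graph.Adj (σ⁻¹ x) (σ⁻¹ y) := Iff.rfl

theorem smul_eq_iff (σ : Equiv.Perm (Fin n)) (T T' : HITree n) :
    σ • T = T' ↔ ∀ x y, T'.graph.Adj (σ x) (σ y) ↔ T.graph.Adj x y := by
  constructor
  · rintro rfl x y
    simp [smul_adj]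
  · intro h
    refine graph_injective (SimpleGraph.ext ?_)
    ext x y
    have := h (σ⁻¹ x) (σ⁻¹ y)
    rw [show σ (σ⁻¹ x) = x from σ.apply_symm_apply x,
      show σ (σ⁻¹ y) = y from σ.apply_symm_apply y] at this
    rw [smul_adj, this]

end HITree

/-- Homeomorphically irreducible trees on `Fin n` with an oriented edge. -/
def HIDart (n : ℕ) : Type := {p : HITree n × Fin n × Fin n // p.1.graph.Adj p.2.1 p.2.2}

namespace HIDart

variable {n : ℕ}

instance : MulAction (Equiv.Perm (Fin n)) (HIDart n) where
  smul σ p := ⟨σ • p.1, by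
    show p.1.1.graph.Adj (σ⁻¹ (σ p.1.2.1)) (σ⁻¹ (σ p.1.2.2))
    simpa using p.2⟩
  one_smul p := rfl
  mul_smul σ τ p := rfl

/-- The tree and the two ends of the oriented edge. -/
def toProd (p : HIDart n) : HITree n × Fin n × Fin n := Subtype.val p

theorem toProd_injective : Function.Injective (toProd (n := n)) := Subtype.val_injective

theorem adj (p : HIDart n) : p.toProd.1.graph.Adj p.toProd.2.1 p.toProd.2.2 := p.2

/-- The reversed oriented edge. -/
def swap (p : HIDart n) : HIDart n := 
  ⟨(p.toProd.1, p.toProd.2.2, p.toProd.2.1), p.adj.symm⟩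

theorem toProd_swap (p : HIDart n) : p.swap.toProd = (p.toProd.1, p.toProd.2.2, p.toProd.2.1) := rfl

theorem toProd_smul (σ : Equiv.Perm (Fin n)) (p : HIDart n) : (σ • p).toProd = σ • p.toProd := rfl

end HIDart

instance (n : ℕ) : Finite (HITree n) := inferInstanceAs (Finite (Subtype _))
instance (n : ℕ) : Finite (HIDart n) := inferInstanceAs (Finite (Subtype _))
noncomputable instance (n : ℕ) : Fintype (HITree n) := Fintype.ofFinite _
noncomputable instance (n : ℕ) : Fintype (HIDart n) := Fintype.ofFinite _

open scoped Classical in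
theorem HIDart.sum_eq {n : ℕ} (f : HITree n × Fin n × Fin n → ℕ) :
    ∑ p : HIDart n, f p.toProd = ∑ T : HITree n, ∑ u, ∑ v, if T.graph.Adj u v then f (T, u, v) else 0 := by
  simp only [← Fintype.sum_prod_type']
  rw [← Finset.sum_filter]
  exact (Finset.sum_subtype _ (by simp) _).symm

open scoped Classical in
/-- The dissimilarity theorem for homeomorphically irreducible trees: isomorphism classes of trees
are counted through trees rooted at a vertex, trees rooted at an oriented edge, and trees rooted
at an oriented edge that can be reversed. -/
theorem two_mul_card_hiTree_add {n : ℕ} {β γ : Type*} (F : HITree n × Fin n → β)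
    (hF : ∀ x y, F x = F y ↔ ∃ g : Equiv.Perm (Fin n), g • x = y) (D : HIDart n → γ × γ)
    (hD : ∀ x y, D x = D y ↔ ∃ g : Equiv.Perm (Fin n), g • x = y)
    (hswap : ∀ x, D x.swap = (D x).swap) :
    2 * Nat.card (Quotient (HITree.isoSetoid n)) + Nat.card (Set.range D)
      = 2 * Nat.card (Set.range F) + Nat.card {b // b ∈ Set.range D ∧ b.swap = b} := by
  have hT : ∀ S T : HITree n, (⟦S⟧ : Quotient (HITree.isoSetoid n)) = ⟦T⟧
      ↔ ∃ g : Equiv.Perm (Fin n), g • S = T := by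
    intro S T
    rw [Quotient.eq]
    constructor
    · rintro ⟨f⟩
      exact ⟨f.toEquiv, (HITree.smul_eq_iff _ _ _).2 fun x y => f.map_adj_iff⟩
    · rintro ⟨g, hg⟩
      exact ⟨⟨g, (HITree.smul_eq_iff _ _ _).1 hg _ _⟩⟩
  have e1 := MulAction.sum_sum_smul_eq_card_mul _ hT id id fun _ => rfl
  have e2 := MulAction.sum_sum_smul_eq_card_mul F hF id id fun _ => rfl
  have e3 := MulAction.sum_sum_smul_eq_card_mul D hD id id fun _ => rfl
  have e4 := MulAction.sum_sum_smul_eq_card_mul D hD HIDart.swap Prod.swap hswap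
  simp only [id, and_true] at e1 e2 e3
  have hr : Nat.card (Quotient (HITree.isoSetoid n)) =
      Nat.card (Set.range fun T => (⟦T⟧ : Quotient (HITree.isoSetoid n))) := by
    have : Set.range (fun T => (⟦T⟧ : Quotient (HITree.isoSetoid n))) = Set.univ :=
      Set.range_eq_univ.2 Quotient.mk_surjective
    rw [this, Nat.card_coe_set_eq, Set.ncard_univ]
  -- For a fixed pair of `g` and a tree, either `g` is an automorphism and the identity for fixed
  -- vertices and edges applies, or every term vanishes.
  have key : 2 * (∑ x : HITree n × Fin n, ∑ g : Equiv.Perm (Fin n), if g • x = x then 1 else 0)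
      + (∑ x : HIDart n, ∑ g : Equiv.Perm (Fin n), if g • x = x.swap then 1 else 0)
      = 2 * (∑ x : HITree n, ∑ g : Equiv.Perm (Fin n), if g • x = x then 1 else 0)
      + (∑ x : HIDart n, ∑ g : Equiv.Perm (Fin n), if g • x = x then 1 else 0) := by
    rw [Finset.sum_comm, Finset.sum_comm (s := (Finset.univ : Finset (HIDart n))),
      Finset.sum_comm (s := (Finset.univ : Finset (HITree n))),
      Finset.sum_comm (s := (Finset.univ : Finset (HIDart n)))]
    rw [Finset.mul_sum, Finset.mul_sum, ← Finset.sum_add_distrib, ← Finset.sum_add_distrib]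
    refine Finset.sum_congr rfl fun g _ => ?_
    have a1 : ∀ x : HIDart n, (g • x = x.swap) ↔ (g • x.toProd.1 = x.toProd.1 ∧ g x.toProd.2.1 = x.toProd.2.2
        ∧ g x.toProd.2.2 = x.toProd.2.1) := by
      intro x
      rw [← HIDart.toProd_injective.eq_iff]
      simp [HIDart.toProd_smul, HIDart.toProd_swap, Prod.ext_iff]
    have a2 : ∀ x : HIDart n, (g • x = x) ↔ (g • x.toProd.1 = x.toProd.1 ∧ g x.toProd.2.1 = x.toProd.2.1
        ∧ g x.toProd.2.2 = x.toProd.2.2) := by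
      intro x
      rw [← HIDart.toProd_injective.eq_iff]
      simp [HIDart.toProd_smul, Prod.ext_iff]
    simp only [a1, a2]
    rw [HIDart.sum_eq (fun x => if (g • x.1 = x.1 ∧ g x.2.1 = x.2.2 ∧ g x.2.2 = x.2.1) then 1 else 0),
      HIDart.sum_eq (fun x => if (g • x.1 = x.1 ∧ g x.2.1 = x.2.1 ∧ g x.2.2 = x.2.2) then 1 else 0),
      Fintype.sum_prod_type, Finset.mul_sum, Finset.mul_sum, ← Finset.sum_add_distrib,
      ← Finset.sum_add_distrib]
    refine Finset.sum_congr rfl fun T _ => ?_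
    by_cases hg : g • T = T
    · let f : T.1 ≃g T.1 := ⟨g, (HITree.smul_eq_iff _ _ _).1 hg _ _⟩
      have : 2 * (∑ v, if g v = v then 1 else 0)
        + (∑ u, ∑ v, if T.graph.Adj u v ∧ g u = v ∧ g v = u then 1 else 0)
        = 2 + ∑ u, ∑ v, if T.graph.Adj u v ∧ g u = u ∧ g v = v then 1 else 0 := by
        convert T.isTree.two_mul_card_fixed_add f <;> rfl
      simpa [Prod.ext_iff, hg, ← ite_and] using this
    · simp [Prod.ext_iff, hg]
  rw [hr]
  rw [e1, e2, e3, e4] at key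
  have hpos : 0 < Fintype.card (Equiv.Perm (Fin n)) := Fintype.card_pos
  have := Nat.eq_of_mul_eq_mul_right hpos
    (show (2 * Nat.card (Set.range F) + Nat.card {b // b ∈ Set.range D ∧ b.swap = b}) * _
      = (2 * Nat.card (Set.range fun T => (⟦T⟧ : Quotient (HITree.isoSetoid n)))
        + Nat.card (Set.range D)) * _ by rw [add_mul, add_mul, mul_assoc, mul_assoc]; exact key)
  exact this.symm

theorem Set.bijective_sigma_val {α ι : Type*} {S : ι → Set α} (hS : ∀ x, ∃! i, x ∈ S i) :
    Function.Bijective (fun z : Σ i, S i => (z.2 : α)) := by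
  constructor
  · rintro ⟨i, x, hx⟩ ⟨j, y, hy⟩ (rfl : x = y)
    obtain rfl := (hS x).unique hx hy
    rfl
  · intro x
    obtain ⟨i, hi, -⟩ := hS x
    exact ⟨⟨i, x, hi⟩, rfl⟩

/-! ### Induced sides, degrees, and gluing of isomorphisms -/

namespace SimpleGraph

variable {V W : Type*} {G : SimpleGraph V} {H : SimpleGraph W}

/-- A connected graph is a tree if there is a height function that separates adjacent vertices and
for which every vertex has at most one lower neighbour. -/
theorem Connected.isTree_of_height (hc : G.Connected) (h : V → ℕ)
    (hne : ∀ x y, G.Adj x y → h x ≠ h y)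
    (huniq : ∀ v y z, G.Adj v y → G.Adj v z → h y < h v → h z < h v → y = z) : G.IsTree := by
  classical
  refine ⟨hc, ?_⟩
  intro v p hp
  -- At a highest vertex of a cycle, the two neighbours on the cycle would be distinct and both
  -- lower.
  obtain ⟨w, hw, hmax⟩ := Finset.exists_max_image p.support.toFinset h
    ⟨v, by simp⟩
  rw [List.mem_toFinset] at hw
  have hq := hp.rotate hw
  have hmem : ∀ x ∈ (p.rotate w hw).support, h x ≤ h w := fun x hx => hmax x (by
    rw [List.mem_toFinset]
    exact (p.mem_support_rotate_iff w hw).1 hx)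
  have hnil := hq.not_nil
  have a1 := (p.rotate w hw).adj_snd hnil
  have a2 := (p.rotate w hw).adj_penultimate hnil
  refine hq.snd_ne_penultimate (huniq w _ _ a1 a2.symm ?_ ?_)
  · exact lt_of_le_of_ne (hmem _ (Walk.getVert_mem_support _ _)) (hne _ _ a1).symm
  · exact lt_of_le_of_ne (hmem _ (Walk.getVert_mem_support _ _)) (hne _ _ a2)

/-- A step towards `v` from within its side stays there, because the distance to `u` drops by at
most one. So the side is connected. -/
theorem IsTree.induce_side (hG : G.IsTree) {u v : V} (h : G.Adj u v) :
    (G.induce (G.side u v)).IsTree := by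
  have hc := hG.connected
  have : Nonempty (G.side u v) := ⟨⟨v, h.right_mem_side⟩⟩
  refine ⟨⟨?_⟩, hG.isAcyclic.induce _⟩
  have key : ∀ n w (hw : w ∈ G.side u v), G.dist w v = n →
      (G.induce (G.side u v)).Reachable ⟨w, hw⟩ ⟨v, h.right_mem_side⟩ := by
    intro n
    induction n with
    | zero =>
      intro w hw hn
      rw [hc.dist_eq_zero_iff] at hn
      subst hn
      rfl
    | succ n ih =>
      intro w hw hn
      have hne : w ≠ v := by rintro rfl; simp at hn
      obtain ⟨z, ⟨hz, hzd⟩, -⟩ := hG.existsUnique_adj_dist_lt hne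
      have h1 := hz.dist_le_succ hc v
      have h2 := hz.dist_le_succ hc u
      have hzS : z ∈ G.side u v := by
        rw [mem_side] at hw ⊢
        simp only [dist_comm (v := v)] at *
        omega
      simp only [dist_comm (u := v)] at h1
      refine Reachable.trans (Adj.reachable ?_) (ih z hzS (by omega))
      exact hz
  exact fun x y => (key _ x.1 x.2 rfl).trans (key _ y.1 y.2 rfl).symm

theorem ncard_neighborSet_induce (S : Set V) (w : S) :
    ((G.induce S).neighborSet w).ncard = (G.neighborSet w ∩ S).ncard := by
  rw [← Set.ncard_image_of_injective _ Subtype.val_injective]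
  congr 1
  ext x
  simp [and_comm]

/-- The only edge leaving the side is at `v`, so no other vertex loses a neighbour. -/
theorem IsTree.ncard_neighborSet_induce_side (hG : G.IsTree) {u v : V} (h : G.Adj u v)
    (w : G.side u v) (hw : w.1 ≠ v) :
    ((G.induce (G.side u v)).neighborSet w).ncard = (G.neighborSet w).ncard := by
  rw [ncard_neighborSet_induce]
  congr 1
  refine Set.inter_eq_left.2 fun x hx => ?_
  by_contra hxS
  rw [hG.notMem_side h] at hxS
  exact hw (hG.eq_of_adj_side h hxS w.2 (G.adj_symm hx)).2

theorem IsTree.ncard_neighborSet_induce_side_root [Finite V] (hG : G.IsTree) {u v : V}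
    (h : G.Adj u v) :
    ((G.induce (G.side u v)).neighborSet ⟨v, h.right_mem_side⟩).ncard + 1
      = (G.neighborSet v).ncard := by
  rw [ncard_neighborSet_induce, ← Set.ncard_sdiff_singleton_add_one (show u ∈ G.neighborSet v from
    h.symm) (Set.toFinite _)]
  congr 2
  ext x
  simp only [Set.mem_inter_iff, mem_neighborSet, Set.mem_sdiff, Set.mem_singleton_iff]
  refine and_congr_right fun hx => ⟨?_, fun hxu => ?_⟩
  · rintro hxS rfl
    exact left_notMem_side hxS
  · by_contra hxS
    rw [hG.notMem_side h] at hxS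
    exact hxu (hG.eq_of_adj_side h hxS h.right_mem_side hx.symm).1

theorem IsTree.children_root (hG : G.IsTree) (r : V) : G.children r r = G.neighborSet r := by
  ext w
  simp only [children, dist_self, mem_neighborSet, Set.mem_ofPred_eq, and_iff_left_iff_imp]
  exact fun h => hG.connected.pos_dist_of_ne h.ne

theorem IsTree.ncard_children_add_one [Finite V] (hG : G.IsTree) {r v : V} (hv : v ≠ r) :
    (G.children r v).ncard + 1 = (G.neighborSet v).ncard := by
  obtain ⟨p, ⟨hp, hpd⟩, hu⟩ := hG.existsUnique_adj_dist_lt hv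
  rw [← Set.ncard_sdiff_singleton_add_one (show p ∈ G.neighborSet v from hp) (Set.toFinite _)]
  congr 2
  ext x
  simp only [children, Set.mem_ofPred_eq, mem_neighborSet, Set.mem_sdiff, Set.mem_singleton_iff]
  refine and_congr_right fun hx => ⟨?_, fun hxp => ?_⟩
  · rintro h rfl
    simp only [dist_comm (v := r)] at hpd
    omega
  · by_contra hle
    have := hG.dist_ne_of_adj r hx
    refine hxp (hu x ⟨hx, ?_⟩)
    simp only [dist_comm (v := r)]
    omega

/-- `S`-trees in terms of degrees. -/
theorem isSTree_iff [Finite V] {r : V} : G.IsSTree r ↔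
    G.IsTree ∧ (G.neighborSet r).ncard ≠ 1 ∧ ∀ v, v ≠ r → (G.neighborSet v).ncard ≠ 2 := by
  refine and_congr_right fun hG => ?_
  constructor
  · intro h
    refine ⟨by rw [← hG.children_root]; exact h r, fun v hv => ?_⟩
    rw [← hG.ncard_children_add_one hv]
    have := h v
    omega
  · rintro ⟨h1, h2⟩ v
    by_cases hv : v = r
    · subst hv
      rwa [hG.children_root]
    · have := h2 v hv
      rw [← hG.ncard_children_add_one hv] at this
      omega

theorem Iso.isSTree [Finite V] [Finite W] (f : G ≃g H) {r : V} (h : G.IsSTree r) :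
    H.IsSTree (f r) := by
  rw [isSTree_iff] at *
  refine ⟨f.isTree_iff.1 h.1, by rw [f.ncard_neighborSet]; exact h.2.1, fun v hv => ?_⟩
  obtain ⟨v, rfl⟩ := f.surjective v
  rw [f.ncard_neighborSet]
  exact h.2.2 v fun e => hv (e ▸ rfl)

/-- Restoring the edge to `u` raises the degree of `v` by one, so the exceptional root condition
"degree not 1" becomes the uniform "degree not 2". -/
theorem IsTree.isSTree_induce_side_iff [Finite V] (hG : G.IsTree) {u v : V} (h : G.Adj u v) :
    (G.induce (G.side u v)).IsSTree ⟨v, h.right_mem_side⟩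
      ↔ ∀ w ∈ G.side u v, (G.neighborSet w).ncard ≠ 2 := by
  rw [isSTree_iff, and_iff_right (hG.induce_side h)]
  have h1 := hG.ncard_neighborSet_induce_side_root h
  constructor
  · rintro ⟨h2, h3⟩ w hw
    by_cases hwv : w = v
    · subst hwv; omega
    · rw [← hG.ncard_neighborSet_induce_side h ⟨w, hw⟩ hwv]
      exact h3 _ fun e => hwv (congrArg Subtype.val e)
  · intro h2
    refine ⟨?_, fun w hw => ?_⟩
    · have := h2 v h.right_mem_side
      omega
    · rw [hG.ncard_neighborSet_induce_side h w fun e => hw (Subtype.ext e)]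
      exact h2 _ w.2

/-- An isomorphism restricts to subsets that correspond under it. -/
def Iso.induceOfMemIff (f : G ≃g H) {S : Set V} {T : Set W} (h : ∀ x, f x ∈ T ↔ x ∈ S) :
    G.induce S ≃g H.induce T where
  toEquiv := f.toEquiv.subtypeEquiv fun x => (h x).symm
  map_rel_iff' := f.map_adj_iff

/-- Isomorphisms between the parts of two partitioned graphs can be glued if they respect the
edges between different parts. -/
theorem exists_iso_of_partition {ι κ : Type*} {S : ι → Set V} {T : κ → Set W}
    (hS : ∀ x, ∃! i, x ∈ S i) (hT : ∀ x, ∃! i, x ∈ T i) (e : ι ≃ κ)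
    (f : ∀ i, G.induce (S i) ≃g H.induce (T (e i)))
    (hf : ∀ i j, i ≠ j → ∀ (x : S i) (y : S j),
      H.Adj (f i x : W) (f j y) ↔ G.Adj (x : V) y) :
    ∃ F : G ≃g H, ∀ i (x : S i), F x = f i x := by
  let a := Equiv.ofBijective _ (Set.bijective_sigma_val hS)
  let b := Equiv.ofBijective _ (Set.bijective_sigma_val hT)
  let F : V ≃ W := (a.symm.trans (Equiv.sigmaCongr e fun i => (f i).toEquiv)).trans b
  have hF : ∀ i (x : S i), F x = f i x := by
    intro i x
    have : a.symm x = ⟨i, x⟩ := a.symm_apply_apply ⟨i, x⟩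
    simp only [F, Equiv.trans_apply, this]
    rfl
  refine ⟨⟨F, ?_⟩, hF⟩
  intro x y
  obtain ⟨i, hi, -⟩ := hS x
  obtain ⟨j, hj, -⟩ := hS y
  rw [hF i ⟨x, hi⟩, hF j ⟨y, hj⟩]
  by_cases hij : i = j
  · subst hij
    exact (f i).map_adj_iff (v := ⟨x, hi⟩) (w := ⟨y, hj⟩)
  · exact hf i j hij ⟨x, hi⟩ ⟨y, hj⟩

end SimpleGraph

/-! ### Isomorphism classes of `S`-trees -/

/-- Isomorphism classes of `S`-trees. -/
abbrev STreeClass : Type := Σ n, Quotient (STree.isoSetoid n)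

namespace STreeClass

variable {V W : Type} [Finite V] [Finite W]

/-- The number of vertices. -/
def size (a : STreeClass) : ℕ := a.1

/-- The isomorphism class of an `S`-tree on an arbitrary vertex set. -/
noncomputable def mk (G : SimpleGraph V) (r : V) (h : G.IsSTree r) : STreeClass :=
  ⟨Nat.card V, ⟦⟨(G.map (Finite.equivFin V).toEmbedding, Finite.equivFin V r),
    (SimpleGraph.Iso.map (Finite.equivFin V) G).isSTree h⟩⟧⟩

theorem size_mk (G : SimpleGraph V) (r : V) (h : G.IsSTree r) : (mk G r h).size = Nat.card V := rfl

theorem mk_eq_iff {G : SimpleGraph V} {r : V} {h : G.IsSTree r} {n : ℕ} {T : STree n} :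
    mk G r h = ⟨n, ⟦T⟧⟩ ↔ ∃ f : G ≃g T.1.1, f r = T.1.2 := by
  let φ := SimpleGraph.Iso.map (Finite.equivFin V) G
  constructor
  · intro e
    obtain ⟨rfl, e⟩ := Sigma.mk.inj_iff.1 e
    obtain ⟨f, hf⟩ := Quotient.exact (eq_of_heq e)
    exact ⟨φ.trans f, hf⟩
  · rintro ⟨f, hf⟩
    obtain rfl : Nat.card V = n := by rw [Nat.card_congr f.toEquiv, Nat.card_fin]
    refine Sigma.ext rfl (heq_of_eq (Quotient.sound ⟨φ.symm.trans f, ?_⟩))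
    rw [← hf]
    exact congrArg f (φ.symm_apply_apply r)

theorem exists_eq_mk (a : STreeClass) :
    ∃ (G : SimpleGraph (Fin a.size)) (r : Fin a.size) (h : G.IsSTree r), mk G r h = a := by
  obtain ⟨n, q⟩ := a
  obtain ⟨T, rfl⟩ := Quotient.exists_rep q
  exact ⟨T.1.1, T.1.2, T.2, mk_eq_iff.2 ⟨.refl, rfl⟩⟩

theorem mk_eq_mk_iff {G : SimpleGraph V} {r : V} {h : G.IsSTree r} {H : SimpleGraph W} {s : W}
    {h' : H.IsSTree s} : mk G r h = mk H s h' ↔ ∃ f : G ≃g H, f r = s := by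
  let φ := SimpleGraph.Iso.map (Finite.equivFin W) H
  refine mk_eq_iff.trans ⟨?_, ?_⟩
  · rintro ⟨f, hf⟩
    refine ⟨f.trans φ.symm, ?_⟩
    rw [RelIso.trans_apply, hf]
    exact φ.symm_apply_apply s
  · rintro ⟨f, hf⟩
    refine ⟨f.trans φ, ?_⟩
    rw [RelIso.trans_apply, hf]
    rfl

theorem size_pos (a : STreeClass) : 0 < a.size := by
  obtain ⟨G, r, -⟩ := a.exists_eq_mk
  exact r.pos

end STreeClass

/-- If the multisets of values of two functions agree, the functions agree up to a bijection. -/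
theorem Multiset.exists_equiv_of_map_univ_eq {ι κ α : Type*} [Fintype ι] [Fintype κ] {f : ι → α}
    {g : κ → α} (h : (Finset.univ.val.map f : Multiset α) = Finset.univ.val.map g) :
    ∃ e : ι ≃ κ, ∀ i, g (e i) = f i := by
  classical
  have hcard : ∀ a, Nonempty ({i // f i = a} ≃ {j // g j = a}) := by
    intro a
    rw [← Fintype.card_eq, Fintype.card_subtype, Fintype.card_subtype]
    have := congrArg (Multiset.count a) h
    rw [Multiset.count_map, Multiset.count_map] at this
    simpa [Finset.card, eq_comm] using this
  exact ⟨Equiv.ofFiberEquiv fun a => (hcard a).some, Equiv.ofFiberEquiv_map _⟩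

/-! ### Decomposition of a rooted tree into branches -/

namespace SimpleGraph

/-- A rooted tree in which no vertex, except possibly the root, has exactly one child. -/
def IsPlanted {V : Type*} (G : SimpleGraph V) (r : V) : Prop :=
  G.IsTree ∧ ∀ v, v ≠ r → (G.neighborSet v).ncard ≠ 2

variable {V W : Type} {G : SimpleGraph V} {H : SimpleGraph W} {r : V} {s : W}

theorem IsPlanted.isSTree_induce_side [Finite V] (h : G.IsPlanted r) {c : V} (hc : G.Adj r c) :
    (G.induce (G.side r c)).IsSTree ⟨c, hc.right_mem_side⟩ :=
  (h.1.isSTree_induce_side_iff hc).2 fun w hw => h.2 w fun e => left_notMem_side (e ▸ hw)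

/-- The isomorphism class of the branch at a child of the root. -/
noncomputable def IsPlanted.branch [Finite V] (h : G.IsPlanted r) (c : G.neighborSet r) : STreeClass :=
  .mk _ _ (h.isSTree_induce_side c.2)

noncomputable instance [Finite V] : Fintype (G.neighborSet r) := Fintype.ofFinite _

/-- The isomorphism classes of the branches at the children of the root. -/
noncomputable def IsPlanted.branches [Finite V] (h : G.IsPlanted r) : Multiset STreeClass :=
  Finset.univ.val.map h.branch

theorem IsPlanted.card_branches [Finite V] (h : G.IsPlanted r) :
    h.branches.card = (G.neighborSet r).ncard := by
  rw [branches, Multiset.card_map, ← Nat.card_coe_set_eq, Nat.card_eq_fintype_card]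
  rfl

/-- The root by itself, and the branches. -/
def branchPart (G : SimpleGraph V) (r : V) : Option (G.neighborSet r) → Set V
  | none => {r}
  | some c => G.side r c

theorem IsTree.existsUnique_mem_branchPart (hG : G.IsTree) (r x : V) :
    ∃! i, x ∈ G.branchPart r i := by
  by_cases hx : r = x
  · subst hx
    refine ⟨none, rfl, ?_⟩
    rintro (_ | c) hc
    · rfl
    · exact absurd hc left_notMem_side
  · obtain ⟨c, ⟨hc, hcd⟩, hu⟩ := hG.existsUnique_adj_dist_lt hx
    refine ⟨some ⟨c, hc⟩, hcd, ?_⟩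
    rintro (_ | d) hd
    · exact absurd hd.symm hx
    · exact congrArg some (Subtype.ext (hu d ⟨d.2, hd⟩))

/-- The only edge leaving a branch goes to the root, which lies in no branch. -/
theorem IsTree.adj_branchPart (hG : G.IsTree) {x y : V} {c d : G.neighborSet r}
    (hx : x ∈ G.side r c) (hy : y ∈ G.side r d) (hcd : c ≠ d) : ¬ G.Adj x y := by
  intro hxy
  have hyc : y ∉ G.side r c := fun hyc => hcd (Option.some_injective _
    ((hG.existsUnique_mem_branchPart r y).unique (y₁ := some c) (y₂ := some d) hyc hy))
  rw [hG.notMem_side c.2] at hyc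
  have := (hG.eq_of_adj_side c.2 hyc hx hxy.symm).1
  exact left_notMem_side (this ▸ hy)

theorem IsTree.adj_root_iff (hG : G.IsTree) {y : V} {d : G.neighborSet r}
    (hy : y ∈ G.side r d) : G.Adj r y ↔ y = d := by
  constructor
  · intro h
    exact (hG.eq_of_adj_side d.2 (d.2.symm.right_mem_side) hy h).2
  · rintro rfl
    exact d.2

theorem IsPlanted.card_eq [Finite V] (h : G.IsPlanted r) :
    Nat.card V = (h.branches.map STreeClass.size).sum + 1 := by
  rw [← Nat.card_congr (Equiv.ofBijective _ (Set.bijective_sigma_val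
    (h.1.existsUnique_mem_branchPart r))), Nat.card_sigma, Fintype.sum_option, add_comm]
  congr 1
  · rw [branches, Multiset.map_map]
    rfl
  · simp [branchPart]

/-- Since nothing is required of the degree of the root, this serves both `S`-trees and
vertex-rooted homeomorphically irreducible trees. -/
theorem IsPlanted.branches_eq_iff [Finite V] [Finite W] (h : G.IsPlanted r) (h' : H.IsPlanted s) :
    h.branches = h'.branches ↔ ∃ f : G ≃g H, f r = s := by
  constructor
  · intro e
    obtain ⟨e, he⟩ := Multiset.exists_equiv_of_map_univ_eq e
    have hb : ∀ c : G.neighborSet r, ∃ f : G.induce (G.side r c) ≃g H.induce (H.side s (e c)),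
        f ⟨c, c.2.right_mem_side⟩ = ⟨e c, (e c).2.right_mem_side⟩ :=
      fun c => STreeClass.mk_eq_mk_iff.1 (he c).symm
    choose f hf using hb
    let F : ∀ i, G.induce (G.branchPart r i) ≃g H.induce (H.branchPart s (e.optionCongr i)) :=
      fun i => match i with
        | none =>
          { toEquiv := (Equiv.Set.singleton.{0, 0} r).trans (Equiv.Set.singleton.{0, 0} s).symm
            map_rel_iff' := by
              rintro ⟨x, rfl⟩ ⟨y, rfl⟩
              exact iff_of_false (H.irrefl) (G.irrefl) }
        | some c => f c
    -- Within a branch only its own root is adjacent to `r`, and `f c` preserves roots of branches.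
    have hcross : ∀ (c : G.neighborSet r) (x : G.side r c), H.Adj s (f c x) ↔ G.Adj r x := by
      intro c x
      rw [h.1.adj_root_iff x.2, h'.1.adj_root_iff (f c x).2]
      have := hf c
      constructor
      · intro hx
        have hx : f c x = ⟨e c, (e c).2.right_mem_side⟩ := Subtype.ext hx
        exact congrArg Subtype.val ((f c).injective (hx.trans (hf c).symm))
      · intro hx
        have hx : x = ⟨c, c.2.right_mem_side⟩ := Subtype.ext hx
        rw [hx, hf]
    obtain ⟨Φ, hΦ⟩ := exists_iso_of_partition (h.1.existsUnique_mem_branchPart r)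
      (h'.1.existsUnique_mem_branchPart s) e.optionCongr F (by
        rintro (_ | c) (_ | d) hij ⟨x, hx⟩ ⟨y, hy⟩
        · exact absurd rfl hij
        · obtain rfl : x = r := hx
          exact hcross d ⟨y, hy⟩
        · obtain rfl : y = r := hy
          rw [adj_comm, G.adj_comm]
          exact hcross c ⟨x, hx⟩
        · have hcd : c ≠ d := fun e => hij (congrArg some e)
          exact iff_of_false (h'.1.adj_branchPart (f c ⟨x, hx⟩).2 (f d ⟨y, hy⟩).2
            fun h => hcd (e.injective h)) (h.1.adj_branchPart hx hy hcd))
    exact ⟨Φ, hΦ none ⟨r, rfl⟩⟩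
  · rintro ⟨f, rfl⟩
    rw [branches, branches, ← Multiset.map_univ_val_equiv (f.mapNeighborSet r), Multiset.map_map]
    refine Multiset.map_congr rfl fun c _ => (STreeClass.mk_eq_mk_iff
      (h := h.isSTree_induce_side c.2)
      (h' := h'.isSTree_induce_side (f.mapNeighborSet r c).2)).2
      ⟨f.induceOfMemIff fun x => f.mem_side_iff h.1.connected, rfl⟩

theorem Iso.isPlanted (f : G ≃g H) (h : G.IsPlanted r) : H.IsPlanted (f r) := by
  refine ⟨f.isTree_iff.1 h.1, fun v hv => ?_⟩
  obtain ⟨v, rfl⟩ := f.surjective v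
  rw [f.ncard_neighborSet]
  exact h.2 v fun e => hv (e ▸ rfl)

/-- Trees with an oriented edge are determined by the two sides of this edge. -/
theorem IsTree.exists_iso_of_sides (hG : G.IsTree) (hH : H.IsTree) {u v : V} {u' v' : W}
    (h : G.Adj u v) (h' : H.Adj u' v')
    (f : G.induce (G.side u v) ≃g H.induce (H.side u' v'))
    (hf : f ⟨v, h.right_mem_side⟩ = ⟨v', h'.right_mem_side⟩)
    (g : G.induce (G.side v u) ≃g H.induce (H.side v' u'))
    (hg : g ⟨u, h.symm.right_mem_side⟩ = ⟨u', h'.symm.right_mem_side⟩) :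
    ∃ F : G ≃g H, F u = u' ∧ F v = v' := by
  have part : ∀ {U : Type} {K : SimpleGraph U} (hK : K.IsTree) {a b : U} (hab : K.Adj a b) (x : U),
      ∃! i : Bool, x ∈ (bif i then K.side a b else K.side b a) := by
    intro U K hK a b hab x
    by_cases hx : x ∈ K.side a b
    · refine ⟨true, hx, ?_⟩
      rintro (_ | _) hi
      · exact absurd hx ((hK.notMem_side hab).2 hi)
      · rfl
    · refine ⟨false, (hK.notMem_side hab).1 hx, ?_⟩
      rintro (_ | _) hi
      · rfl
      · exact absurd hi hx
  -- The sides are joined only by the edge between their roots, and `f`, `g` match roots.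
  have hcross : ∀ (x : G.side u v) (y : G.side v u), H.Adj (f x : W) (g y) ↔ G.Adj (x : V) y := by
    intro x y
    constructor
    · intro hxy
      obtain ⟨h1, h2⟩ := hH.eq_of_adj_side h' (g y).2 (f x).2 hxy.symm
      have h1 := g.injective ((Subtype.ext h1 : g y = ⟨u', _⟩).trans hg.symm)
      have h2 := f.injective ((Subtype.ext h2 : f x = ⟨v', _⟩).trans hf.symm)
      rw [h1, h2]
      exact h.symm
    · intro hxy
      obtain ⟨h1, h2⟩ := hG.eq_of_adj_side h y.2 x.2 hxy.symm
      rw [show x = ⟨v, h.right_mem_side⟩ from Subtype.ext h2,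
        show y = ⟨u, h.symm.right_mem_side⟩ from Subtype.ext h1, hf, hg]
      exact h'.symm
  obtain ⟨F, hF⟩ := exists_iso_of_partition (part hG h) (part hH h') (Equiv.refl Bool)
    (fun i => match i with
      | true => f
      | false => g) (by
      rintro (_ | _) (_ | _) hij x y
      · exact absurd rfl hij
      · rw [adj_comm, G.adj_comm]
        exact hcross y x
      · exact hcross x y
      · exact absurd rfl hij)
  refine ⟨F, ?_, ?_⟩
  · exact (hF false ⟨u, h.symm.right_mem_side⟩).trans (congrArg Subtype.val hg)
  · exact (hF true ⟨v, h.right_mem_side⟩).trans (congrArg Subtype.val hf)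

end SimpleGraph

/-! ### Building trees from prescribed branches or sides -/

namespace SimpleGraph

section Bouquet

variable {ι : Type*} {V : ι → Type*} (G : ∀ i, SimpleGraph (V i)) (ρ : ∀ i, V i) (o : ι)

/-- The disjoint union of a family of rooted graphs, with the root of the graph with index `o`
joined to the other roots. -/
def bouquet : SimpleGraph (Σ i, V i) where
  Adj p q := (∃ h : p.1 = q.1, (G q.1).Adj (h ▸ p.2) q.2) ∨
    (p.1 ≠ q.1 ∧ (p.1 = o ∨ q.1 = o) ∧ p.2 = ρ p.1 ∧ q.2 = ρ q.1)
  symm := ⟨by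
    rintro ⟨i, x⟩ ⟨j, y⟩ (⟨h, hxy⟩ | ⟨h1, h2, h3, h4⟩)
    · obtain rfl : i = j := h
      exact Or.inl ⟨rfl, hxy.symm⟩
    · exact Or.inr ⟨h1.symm, h2.symm, h4, h3⟩⟩
  loopless := ⟨by
    rintro ⟨i, x⟩ (⟨h, hxy⟩ | ⟨h1, -⟩)
    · exact (G i).irrefl hxy
    · exact h1 rfl⟩

variable {G ρ o}

theorem bouquet_adj_same {i : ι} {x y : V i} :
    (bouquet G ρ o).Adj ⟨i, x⟩ ⟨i, y⟩ ↔ (G i).Adj x y := by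
  constructor
  · rintro (⟨h, hxy⟩ | ⟨h, -⟩)
    · exact hxy
    · exact absurd rfl h
  · exact fun h => Or.inl ⟨rfl, h⟩

theorem bouquet_adj_of_ne {p q : Σ i, V i} (h : p.1 ≠ q.1) :
    (bouquet G ρ o).Adj p q ↔ (p.1 = o ∨ q.1 = o) ∧ p = ⟨p.1, ρ p.1⟩ ∧ q = ⟨q.1, ρ q.1⟩ := by
  obtain ⟨i, x⟩ := p
  obtain ⟨j, y⟩ := q
  constructor
  · rintro (⟨h', -⟩ | ⟨-, h1, h2, h3⟩)
    · exact absurd h' h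
    · exact ⟨h1, Sigma.ext rfl (heq_of_eq h2), Sigma.ext rfl (heq_of_eq h3)⟩
  · rintro ⟨h1, h2, h3⟩
    exact Or.inr ⟨h, h1, eq_of_heq (Sigma.mk.inj_iff.1 h2).2, eq_of_heq (Sigma.mk.inj_iff.1 h3).2⟩

theorem bouquet_adj_roots {i : ι} (h : i ≠ o) :
    (bouquet G ρ o).Adj ⟨o, ρ o⟩ ⟨i, ρ i⟩ :=
  (bouquet_adj_of_ne (p := ⟨o, ρ o⟩) (q := ⟨i, ρ i⟩) h.symm).2 ⟨Or.inl rfl, rfl, rfl⟩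

/-- Distance to the root of the component, plus one outside component `o`, is a height with at most
one lower neighbour per vertex: inside a component by the tree property, across components only from
`ρ i` to `ρ o`. -/
theorem isTree_bouquet (hG : ∀ i, (G i).IsTree) : (bouquet G ρ o).IsTree := by
  classical
  have hr : ∀ i x, (bouquet G ρ o).Reachable ⟨i, x⟩ ⟨i, ρ i⟩ := fun i x =>
    ((hG i).connected.preconnected x (ρ i)).map
      ⟨fun y => (⟨i, y⟩ : Σ i, V i), fun h => bouquet_adj_same.2 h⟩
  have hr' : ∀ p, (bouquet G ρ o).Reachable p ⟨o, ρ o⟩ := by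
    rintro ⟨i, x⟩
    refine (hr i x).trans ?_
    by_cases hi : i = o
    · subst hi; rfl
    · exact (bouquet_adj_roots hi).symm.reachable
  have hc : (bouquet G ρ o).Connected := by
    have : Nonempty (Σ i, V i) := ⟨⟨o, ρ o⟩⟩
    exact ⟨fun p q => (hr' p).trans (hr' q).symm⟩
  let ht : (Σ i, V i) → ℕ := fun p =>
    (G p.1).dist (ρ p.1) p.2 + if p.1 = o then 0 else 1
  have hroot : ∀ i, ht ⟨i, ρ i⟩ = if i = o then 0 else 1 := by intro i; simp [ht]
  have hlow : ∀ p q, p.1 ≠ q.1 → (bouquet G ρ o).Adj p q → ht q < ht p →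
      q = ⟨o, ρ o⟩ ∧ p = ⟨p.1, ρ p.1⟩ := by
    intro p q hne h hlt
    obtain ⟨h1, h2, h3⟩ := (bouquet_adj_of_ne hne).1 h
    rw [h2, h3, hroot, hroot] at hlt
    have hq : q.1 = o := by
      by_contra hq
      rw [if_neg hq] at hlt
      split_ifs at hlt <;> omega
    refine ⟨?_, h2⟩
    rw [h3]
    exact congrArg (fun i => (⟨i, ρ i⟩ : Σ i, V i)) hq
  have hsame : ∀ i x y, ht ⟨i, x⟩ < ht ⟨i, y⟩ → (G i).dist x (ρ i) < (G i).dist y (ρ i) := by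
    intro i x y h
    simp only [ht] at h
    rw [dist_comm (v := ρ i), dist_comm (v := ρ i)]
    omega
  refine hc.isTree_of_height ht ?_ ?_
  · rintro ⟨i, x⟩ ⟨j, y⟩ h
    by_cases hij : i = j
    · subst hij
      have := (hG i).dist_ne_of_adj (ρ i) (bouquet_adj_same.1 h)
      simp only [ht]
      omega
    · obtain ⟨h1, h2, h3⟩ := (bouquet_adj_of_ne hij).1 h
      rw [h2, h3, hroot, hroot]
      have : ¬ (i = o ∧ j = o) := fun e => hij (e.1.trans e.2.symm)
      simp only at h1 ⊢
      split_ifs <;> first | omega | tauto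
  · rintro ⟨i, x⟩ ⟨j, y⟩ ⟨k, z⟩ h1 h2 h3 h4
    by_cases hj : i = j <;> by_cases hk : i = k
    · subst hj hk
      have h3 := hsame _ _ _ h3
      have hne : x ≠ ρ i := by rintro rfl; simp at h3
      rw [((hG i).existsUnique_adj_dist_lt hne).unique ⟨bouquet_adj_same.1 h1, h3⟩
        ⟨bouquet_adj_same.1 h2, hsame _ _ _ h4⟩]
    · subst hj
      have e := (hlow _ _ hk h2 h4).2
      rw [e] at h3
      have h3 := hsame _ _ _ h3
      simp at h3
    · subst hk
      have e := (hlow _ _ hj h1 h3).2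
      rw [e] at h4
      have h4 := hsame _ _ _ h4
      simp at h4
    · rw [(hlow _ _ hj h1 h3).1, (hlow _ _ hk h2 h4).1]

theorem mem_side_bouquet (hG : ∀ i, (G i).IsTree) {i : ι} (hi : i ≠ o) (p : Σ i, V i) :
    p ∈ (bouquet G ρ o).side ⟨o, ρ o⟩ ⟨i, ρ i⟩ ↔ p.1 = i := by
  rw [← (isTree_bouquet hG).eq_side (S := {p | p.1 = i}) hi.symm rfl]
  · rfl
  · intro p q (hp : p.1 ≠ i) (hq : q.1 = i) h
    obtain ⟨h1, h2, h3⟩ := (bouquet_adj_of_ne fun e => hp (e.trans hq)).1 h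
    have h1 : p.1 = o := h1.resolve_right fun e => hi (hq.symm.trans e)
    rw [h2, h3]
    exact ⟨congrArg (fun i => (⟨i, ρ i⟩ : Σ i, V i)) h1,
      congrArg (fun i => (⟨i, ρ i⟩ : Σ i, V i)) hq⟩

theorem mem_side_bouquet_symm (hG : ∀ i, (G i).IsTree) {i : ι} (hi : i ≠ o) (p : Σ i, V i) :
    p ∈ (bouquet G ρ o).side ⟨i, ρ i⟩ ⟨o, ρ o⟩ ↔ p.1 ≠ i := by
  rw [← (isTree_bouquet hG).notMem_side (bouquet_adj_roots hi), mem_side_bouquet hG hi]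

/-- A member of the family as an induced subgraph of the bouquet. -/
theorem exists_iso_induce_bouquet {i : ι} {S : Set (Σ i, V i)} (hS : ∀ p, p ∈ S ↔ p.1 = i) :
    ∃ f : G i ≃g (bouquet G ρ o).induce S, f (ρ i) = ⟨⟨i, ρ i⟩, (hS _).2 rfl⟩ := by
  let f : V i → S := fun x => ⟨⟨i, x⟩, (hS _).2 rfl⟩
  have hf : Function.Bijective f := by
    constructor
    · intro x y h
      exact eq_of_heq (Sigma.mk.inj_iff.1 (congrArg Subtype.val h)).2
    · rintro ⟨⟨j, y⟩, hy⟩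
      obtain rfl : j = i := (hS _).1 hy
      exact ⟨y, rfl⟩
  exact ⟨⟨Equiv.ofBijective f hf, bouquet_adj_same⟩, rfl⟩

end Bouquet

theorem exists_branches_eq (m : Multiset STreeClass) :
    ∃ (V : Type) (_ : Finite V) (G : SimpleGraph V) (r : V) (h : G.IsPlanted r),
      h.branches = m := by
  obtain ⟨l, rfl⟩ := Quotient.exists_rep m
  choose G r hS hmk using fun i => (l.get i).exists_eq_mk
  -- Index `none` carries a single vertex, the new root, to which the roots of all listed trees are
  -- joined.
  let n : Option (Fin l.length) → ℕ := fun i => i.elim 1 fun i => (l.get i).size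
  let G' : ∀ i, SimpleGraph (Fin (n i)) := fun i => match i with
    | none => (⊥ : SimpleGraph (Fin 1))
    | some i => G i
  let r' : ∀ i, Fin (n i) := fun i => match i with
    | none => (0 : Fin 1)
    | some i => r i
  have hG' : ∀ i, (G' i).IsTree := by
    rintro (_ | i)
    · exact IsTree.of_subsingleton (V := Fin 1)
    · exact (hS i).1
  have hT := isTree_bouquet (ρ := r') (o := none) hG'
  have hadj := fun i => bouquet_adj_roots (G := G') (ρ := r') (o := none) (Option.some_ne_none i)
  have hside := fun i => mem_side_bouquet (ρ := r') hG' (Option.some_ne_none i)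
  choose f hf using fun i =>
    exists_iso_induce_bouquet (G := G') (ρ := r') (o := none) (hside i)
  have hST : ∀ i, ((bouquet G' r' none).induce _).IsSTree ⟨_, (hadj i).right_mem_side⟩ := fun i => by
    have := (f i).isSTree (hS i)
    rw [show f i (r i) = _ from hf i] at this
    exact this
  have hP : (bouquet G' r' none).IsPlanted ⟨none, r' none⟩ := by
    refine ⟨hT, ?_⟩
    rintro ⟨_ | i, x⟩ hx
    · exact absurd (congrArg _ (Subsingleton.elim (α := Fin 1) _ _)) hx
    · exact (hT.isSTree_induce_side_iff (hadj i)).1 (hST i) _ ((hside i _).2 rfl)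
  refine ⟨_, inferInstance, _, _, hP, ?_⟩
  let e : Fin l.length ≃ (bouquet G' r' none).neighborSet ⟨none, r' none⟩ :=
    Equiv.ofBijective (fun i => ⟨⟨some i, r' (some i)⟩, hadj i⟩) (by
      constructor
      · intro i j h
        exact Option.some_injective _ (congrArg (fun z => z.1.1) h)
      · rintro ⟨⟨_ | i, x⟩, hx⟩
        · exact absurd (Subsingleton.elim (α := Fin 1) _ _) (bouquet_adj_same.1 hx).ne
        · refine ⟨i, Subtype.ext ?_⟩
          exact ((bouquet_adj_of_ne (by simp)).1 hx).2.2.symm)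
  rw [IsPlanted.branches, ← Multiset.map_univ_val_equiv e, Multiset.map_map]
  have : hP.branch ∘ e = l.get := by
    funext i
    exact ((STreeClass.mk_eq_mk_iff (h := hS i) (h' := hST i)).2 ⟨f i, hf i⟩).symm.trans (hmk i)
  rw [this, Fin.univ_val_map, List.ofFn_get]
  rfl

/-- Join the roots of the two `S`-trees by an edge; each root gains a neighbour, so no vertex ends
up with degree 2. -/
theorem exists_mk_side_eq (a : Bool → STreeClass) :
    ∃ (V : Type) (_ : Finite V) (G : SimpleGraph V) (u v : V) (h : G.Adj u v) (hG : G.IsTree)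
      (hdeg : ∀ w, (G.neighborSet w).ncard ≠ 2),
      STreeClass.mk _ _ ((hG.isSTree_induce_side_iff h).2 fun w _ => hdeg w) = a true ∧
      STreeClass.mk _ _ ((hG.isSTree_induce_side_iff h.symm).2 fun w _ => hdeg w) = a false := by
  choose G r hS hmk using fun i => (a i).exists_eq_mk
  have hT := isTree_bouquet (ρ := r) (o := false) fun i => (hS i).1
  have hadj := bouquet_adj_roots (G := G) (ρ := r) (o := false) (i := true) (by simp)
  have hs1 := mem_side_bouquet (ρ := r) (o := false) (i := true) (fun i => (hS i).1) (by simp)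
  have hs2 : ∀ p, p ∈ (bouquet G r false).side ⟨true, r true⟩ ⟨false, r false⟩ ↔ p.1 = false := by
    intro p
    rw [mem_side_bouquet_symm (fun i => (hS i).1) (by simp)]
    simp
  obtain ⟨f, hf⟩ := exists_iso_induce_bouquet hs1
  obtain ⟨g, hg⟩ := exists_iso_induce_bouquet hs2
  have hST1 := f.isSTree (hS true)
  have hST2 := g.isSTree (hS false)
  rw [hf] at hST1
  rw [hg] at hST2
  refine ⟨_, inferInstance, _, _, _, hadj, hT, ?_, ?_, ?_⟩
  · rintro ⟨_ | _, x⟩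
    · exact (hT.isSTree_induce_side_iff hadj.symm).1 hST2 _ ((hs2 _).2 rfl)
    · exact (hT.isSTree_induce_side_iff hadj).1 hST1 _ ((hs1 _).2 rfl)
  · exact ((STreeClass.mk_eq_mk_iff (h := hS true) (h' := hST1)).2 ⟨f, hf⟩).symm.trans (hmk true)
  · exact ((STreeClass.mk_eq_mk_iff (h := hS false) (h' := hST2)).2 ⟨g, hg⟩).symm.trans (hmk false)

end SimpleGraph

/-! ### Counting trees by multisets and pairs of `S`-trees -/

open SimpleGraph

theorem SimpleGraph.exists_branches_eq_fin {m : Multiset STreeClass} {n : ℕ}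
    (hm : (m.map STreeClass.size).sum + 1 = n) :
    ∃ (G : SimpleGraph (Fin n)) (r : Fin n) (h : G.IsPlanted r), h.branches = m := by
  obtain ⟨V, hV, G, r, h, rfl⟩ := exists_branches_eq m
  rw [← h.card_eq] at hm
  subst hm
  let f := Iso.map (Finite.equivFin V) G
  exact ⟨_, f r, f.isPlanted h, ((h.branches_eq_iff (f.isPlanted h)).2 ⟨f, rfl⟩).symm⟩

theorem Nat.card_quotient_eq_card_range {α β : Type*} (s : Setoid α) (F : α → β)
    (hF : ∀ a b, F a = F b ↔ s a b) : Nat.card (Quotient s) = Nat.card (Set.range F) := by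
  obtain rfl : s = Setoid.ker F := Setoid.ext fun a b => (hF a b).symm
  exact Nat.card_congr (Setoid.quotientKerEquivRange F)

theorem STree.isPlanted {n : ℕ} (T : STree n) : T.1.1.IsPlanted T.1.2 :=
  ⟨T.2.1, (isSTree_iff.1 T.2).2.2⟩

/-- The number of branches is the degree of the root, and `+ 1` accounts for the root itself. -/
theorem STree.card_quotient (n : ℕ) : Nat.card (Quotient (STree.isoSetoid n)) =
    Nat.card {m : Multiset STreeClass // (m.map STreeClass.size).sum + 1 = n ∧ m.card ≠ 1} := by
  rw [Nat.card_quotient_eq_card_range _ (fun T : STree n => T.isPlanted.branches)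
    fun S T => S.isPlanted.branches_eq_iff T.isPlanted]
  refine Nat.card_congr (Equiv.subtypeEquivRight fun m => ⟨?_, ?_⟩)
  · rintro ⟨T, rfl⟩
    refine ⟨by rw [← T.isPlanted.card_eq, Nat.card_fin], ?_⟩
    rw [IsPlanted.card_branches]
    exact (isSTree_iff.1 T.2).2.1
  · rintro ⟨hm, hc⟩
    obtain ⟨G, r, h, rfl⟩ := exists_branches_eq_fin hm
    rw [IsPlanted.card_branches] at hc
    exact ⟨⟨(G, r), isSTree_iff.2 ⟨h.1, hc, h.2⟩⟩, rfl⟩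

theorem HITree.isPlanted {n : ℕ} (T : HITree n) (r : Fin n) : T.graph.IsPlanted r :=
  ⟨T.isTree, fun v _ => T.ncard_neighborSet_ne v⟩

theorem HITree.isSTree_induce_side {n : ℕ} (T : HITree n) {u v : Fin n} (h : T.graph.Adj u v) :
    (T.graph.induce (T.graph.side u v)).IsSTree ⟨v, h.right_mem_side⟩ :=
  (T.isTree.isSTree_induce_side_iff h).2 fun w _ => T.ncard_neighborSet_ne w

/-- A permutation moving one homeomorphically irreducible tree to another is an isomorphism. -/
def HITree.isoOfSMulEq {n : ℕ} {S T : HITree n} {g : Equiv.Perm (Fin n)} (h : g • S = T) :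
    S.graph ≃g T.graph :=
  ⟨g, (HITree.smul_eq_iff _ _ _).1 h _ _⟩

theorem HITree.smul_eq_of_iso {n : ℕ} {S T : HITree n} (f : S.graph ≃g T.graph) :
    (f.toEquiv : Equiv.Perm (Fin n)) • S = T :=
  (HITree.smul_eq_iff _ _ _).2 fun _ _ => f.map_adj_iff

/-- The classes of the two sides of an oriented edge. -/
noncomputable def HIDart.sides {n : ℕ} (p : HIDart n) : STreeClass × STreeClass :=
  (.mk _ _ (p.toProd.1.isSTree_induce_side p.adj), .mk _ _ (p.toProd.1.isSTree_induce_side p.adj.symm))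

theorem HIDart.sides_eq_iff {n : ℕ} (p q : HIDart n) :
    p.sides = q.sides ↔ ∃ g : Equiv.Perm (Fin n), g • p = q := by
  constructor
  · intro h
    obtain ⟨f, hf⟩ := (STreeClass.mk_eq_mk_iff (h := p.toProd.1.isSTree_induce_side p.adj)
      (h' := q.toProd.1.isSTree_induce_side q.adj)).1 (congrArg Prod.fst h)
    obtain ⟨g, hg⟩ := (STreeClass.mk_eq_mk_iff (h := p.toProd.1.isSTree_induce_side p.adj.symm)
      (h' := q.toProd.1.isSTree_induce_side q.adj.symm)).1 (congrArg Prod.snd h)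
    obtain ⟨F, hF1, hF2⟩ := p.toProd.1.isTree.exists_iso_of_sides q.toProd.1.isTree p.adj q.adj
      f hf g hg
    exact ⟨F.toEquiv, HIDart.toProd_injective
      (Prod.ext (HITree.smul_eq_of_iso F) (Prod.ext hF1 hF2))⟩
  · rintro ⟨g, rfl⟩
    let F : p.toProd.1.graph ≃g (g • p).toProd.1.graph := HITree.isoOfSMulEq rfl
    have hc := p.toProd.1.isTree.connected
    refine Prod.ext ?_ ?_
    · refine (STreeClass.mk_eq_mk_iff (h := p.toProd.1.isSTree_induce_side p.adj)
        (h' := (g • p).toProd.1.isSTree_induce_side (g • p).adj)).2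
        ⟨F.induceOfMemIff fun x => F.mem_side_iff hc, rfl⟩
    · refine (STreeClass.mk_eq_mk_iff (h := p.toProd.1.isSTree_induce_side p.adj.symm)
        (h' := (g • p).toProd.1.isSTree_induce_side (g • p).adj.symm)).2
        ⟨F.induceOfMemIff fun x => F.mem_side_iff hc, rfl⟩

theorem SimpleGraph.IsTree.card_side_add {V : Type*} [Finite V] {G : SimpleGraph V}
    (hG : G.IsTree) {u v : V} (h : G.Adj u v) :
    Nat.card (G.side u v) + Nat.card (G.side v u) = Nat.card V := by
  rw [← hG.compl_side h]
  exact Set.ncard_add_ncard_compl _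

theorem HIDart.range_sides (n : ℕ) (a : STreeClass × STreeClass) :
    a ∈ Set.range (sides (n := n)) ↔ a.1.size + a.2.size = n := by
  constructor
  · rintro ⟨p, rfl⟩
    simp only [sides, STreeClass.size_mk]
    rw [p.toProd.1.isTree.card_side_add p.adj, Nat.card_fin]
  · intro ha
    obtain ⟨V, hV, G, u, v, h, hG, hdeg, h1, h2⟩ :=
      exists_mk_side_eq fun b => bif b then a.1 else a.2
    have h1 : _ = a.1 := h1
    have h2 : _ = a.2 := h2
    have hn : Nat.card V = n := by
      rw [← ha, ← h1, ← h2, STreeClass.size_mk, STreeClass.size_mk, hG.card_side_add h]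
    subst hn
    let f := Iso.map (Finite.equivFin V) G
    let T : HITree (Nat.card V) := HITree.ofNcard _ (f.isTree_iff.1 hG) fun w => by
      obtain ⟨w, rfl⟩ := f.surjective w
      rw [f.ncard_neighborSet]
      exact hdeg w
    let p : HIDart (Nat.card V) := ⟨(T, f u, f v), f.map_adj_iff.2 h⟩
    refine ⟨p, Prod.ext (Eq.trans ?_ h1) (Eq.trans ?_ h2)⟩
    · exact ((STreeClass.mk_eq_mk_iff (h' := p.toProd.1.isSTree_induce_side p.adj)).2
        ⟨f.induceOfMemIff fun x => f.mem_side_iff hG.connected, rfl⟩).symm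
    · exact ((STreeClass.mk_eq_mk_iff (h' := p.toProd.1.isSTree_induce_side p.adj.symm)).2
        ⟨f.induceOfMemIff fun x => f.mem_side_iff hG.connected, rfl⟩).symm

/-- The number of homeomorphically irreducible trees in terms of `S`-trees. -/
theorem HITree.two_mul_card_quotient_add (n : ℕ) :
    2 * Nat.card (Quotient (HITree.isoSetoid n))
        + Nat.card {p : STreeClass × STreeClass // p.1.size + p.2.size = n}
      = 2 * Nat.card
          {m : Multiset STreeClass // (m.map STreeClass.size).sum + 1 = n ∧ m.card ≠ 2}
        + Nat.card {a : STreeClass // 2 * a.size = n} := by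
  have := two_mul_card_hiTree_add (n := n) (fun p => (p.1.isPlanted p.2).branches)
    (by
      rintro ⟨S, u⟩ ⟨T, v⟩
      rw [IsPlanted.branches_eq_iff]
      constructor
      · rintro ⟨f, hf⟩
        exact ⟨f.toEquiv, Prod.ext (HITree.smul_eq_of_iso f) hf⟩
      · rintro ⟨g, hg⟩
        exact ⟨HITree.isoOfSMulEq (congrArg Prod.fst hg), congrArg Prod.snd hg⟩)
    HIDart.sides HIDart.sides_eq_iff fun _ => rfl
  convert this using 2
  · exact Nat.card_congr (Equiv.subtypeEquivRight fun a => (HIDart.range_sides n a).symm)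
  · congr 1
    refine Nat.card_congr (Equiv.subtypeEquivRight fun m => ⟨?_, ?_⟩)
    · rintro ⟨hm, hc⟩
      obtain ⟨G, r, h, rfl⟩ := exists_branches_eq_fin hm
      rw [IsPlanted.card_branches] at hc
      refine ⟨⟨HITree.ofNcard G h.1 fun v => ?_, r⟩, rfl⟩
      by_cases hv : v = r
      · rwa [hv]
      · exact h.2 v hv
    · rintro ⟨⟨T, r⟩, rfl⟩
      refine ⟨by rw [← (T.isPlanted r).card_eq, Nat.card_fin], ?_⟩
      rw [IsPlanted.card_branches]
      exact T.ncard_neighborSet_ne r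
  -- A pair of sides invariant under the swap is diagonal, hence a single `S`-tree of half the size.
  · refine Nat.card_congr
      { toFun := fun a => ⟨(a.1, a.1), (HIDart.range_sides _ _).2 (by rw [← two_mul]; exact a.2), rfl⟩
        invFun := fun a => ⟨a.1.1, ?_⟩
        left_inv := fun a => rfl
        right_inv := ?_ }
    · have := (HIDart.range_sides _ _).1 a.2.1
      have h2 : a.1.2 = a.1.1 := congrArg Prod.fst a.2.2
      rw [h2] at this
      omega
    · intro a
      have h2 : a.1.2 = a.1.1 := congrArg Prod.fst a.2.2
      exact Subtype.ext (Prod.ext rfl h2.symm)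

/-! ### Multisets and pairs of weighted objects -/

section Weighted

variable {α : Type*} (w : α → ℕ)

/-- The generating function of a type of weighted objects. -/
noncomputable def weightGF : ℚ⟦X⟧ := PowerSeries.mk fun n => (Nat.card {a // w a = n} : ℚ)

/-- The weight of a multiset. -/
def multisetWeight (m : Multiset α) : ℕ := (m.map w).sum

variable {w}

theorem multisetWeight_add (m m' : Multiset α) :
    multisetWeight w (m + m') = multisetWeight w m + multisetWeight w m' := by
  simp [multisetWeight]

theorem multisetWeight_replicate (k : ℕ) (a : α) :
    multisetWeight w (Multiset.replicate k a) = k * w a := by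
  simp [multisetWeight]

theorem le_multisetWeight {m : Multiset α} {a : α} (h : a ∈ m) : w a ≤ multisetWeight w m :=
  Multiset.le_sum_of_mem (Multiset.mem_map_of_mem w h)

theorem card_le_multisetWeight (hw : ∀ a, 0 < w a) (m : Multiset α) :
    m.card ≤ multisetWeight w m := by
  have := Multiset.card_nsmul_le_sum (s := m.map w) (a := 1) (by
    intro x hx
    obtain ⟨a, -, rfl⟩ := Multiset.mem_map.1 hx
    exact hw a)
  simpa [multisetWeight] using this

theorem finite_weight_le (hfin : ∀ n, {a | w a = n}.Finite) (n : ℕ) : {a | w a ≤ n}.Finite := by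
  have : {a | w a ≤ n} = ⋃ i ∈ Finset.range (n + 1), {a | w a = i} := by
    ext a
    simp
  rw [this]
  exact Set.Finite.biUnion (Finset.finite_toSet _) fun i _ => hfin i

/-- Such a multiset lies below the one containing `n` copies of each element of weight at most `n`.
-/
theorem finite_multisetWeight_eq (hw : ∀ a, 0 < w a) (hfin : ∀ n, {a | w a = n}.Finite) (n : ℕ) :
    {m | multisetWeight w m = n}.Finite := by
  classical
  refine (Set.finite_Iic (n • (finite_weight_le hfin n).toFinset.val)).subset fun m hm => ?_
  rw [Set.mem_Iic, Multiset.le_iff_count]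
  intro a
  by_cases ha : a ∈ m
  · have h1 : w a ≤ n := hm ▸ le_multisetWeight ha
    have h2 : Multiset.count a (finite_weight_le hfin n).toFinset.val = 1 :=
      Multiset.count_eq_one_of_mem (Finset.nodup _) (by simpa using h1)
    rw [Multiset.count_nsmul, h2, mul_one]
    exact (Multiset.count_le_card a m).trans (hm ▸ card_le_multisetWeight hw m)
  · rw [Multiset.count_eq_zero_of_notMem ha]
    exact Nat.zero_le _

open Finset in
/-- Multisets of weight `n` are counted by taking `k` copies of an element out of them. -/
theorem mul_card_multisetWeight_eq (hw : ∀ a, 0 < w a) (hfin : ∀ n, {a | w a = n}.Finite)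
    (n : ℕ) : n * Nat.card {m // multisetWeight w m = n} = ∑ p ∈ antidiagonal n,
      (∑ k ∈ p.1.divisors, p.1 / k * Nat.card {a // w a = p.1 / k})
        * Nat.card {m // multisetWeight w m = p.2} := by
  classical
  let S : ℕ → Finset (Multiset α) := fun j => (finite_multisetWeight_eq hw hfin j).toFinset
  have hS : ∀ j m, m ∈ S j ↔ multisetWeight w m = j := fun j m => by simp [S]
  have hScard : ∀ j, Nat.card {m // multisetWeight w m = j} = (S j).card := by
    intro j
    rw [← Nat.card_eq_finsetCard]
    exact Nat.card_congr (Equiv.subtypeEquivRight fun m => (hS j m).symm)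
  let U : Finset α := (finite_weight_le hfin n).toFinset
  have hU : ∀ a, a ∈ U ↔ w a ≤ n := fun a => by simp [U]
  have hfib : ∀ k i, 0 < k → i ≤ n →
      (∑ a ∈ U, if k * w a = i then w a else 0)
        = if k ∣ i then i / k * Nat.card {a // w a = i / k} else 0 := by
    intro k i hk hi
    split_ifs with h
    · obtain ⟨d, rfl⟩ := h
      rw [Nat.mul_div_cancel_left _ hk, ← sum_filter]
      have hdn : d ≤ n := (Nat.le_mul_of_pos_left d hk).trans hi
      have : Nat.card {a // w a = d} = (U.filter fun a => k * w a = k * d).card := by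
        rw [← Nat.card_eq_finsetCard]
        refine Nat.card_congr (Equiv.subtypeEquivRight fun a => ?_)
        rw [mem_filter, hU, Nat.mul_right_inj hk.ne']
        constructor
        · rintro rfl; exact ⟨hdn, rfl⟩
        · exact fun h => h.2
      rw [this, mul_comm d]
      refine sum_const_nat fun a ha => ?_
      exact Nat.eq_of_mul_eq_mul_left hk (mem_filter.1 ha).2
    · refine sum_eq_zero fun a _ => if_neg ?_
      rintro rfl
      exact h (Dvd.intro _ rfl)
  have hc : ∀ i ≤ n, (∑ k ∈ i.divisors, i / k * Nat.card {a // w a = i / k})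
      = ∑ k ∈ Icc 1 n, ∑ a ∈ U, if k * w a = i then w a else 0 := by
    intro i hi
    rw [sum_congr rfl fun k hk => hfib k i (mem_Icc.1 hk).1 hi, ← sum_filter]
    rcases Nat.eq_zero_or_pos i with rfl | hpos
    · simp
    · refine sum_congr ?_ fun _ _ => rfl
      ext k
      simp only [Nat.mem_divisors, mem_filter, mem_Icc]
      constructor
      · rintro ⟨h1, -⟩
        exact ⟨⟨Nat.pos_of_dvd_of_pos h1 hpos, (Nat.le_of_dvd hpos h1).trans hi⟩, h1⟩
      · rintro ⟨-, h1⟩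
        exact ⟨h1, hpos.ne'⟩
  -- Removing `k` copies of `a` is a bijection onto the multisets of weight `n - k * w a`.
  have hcount : ∀ k a, ((S n).filter fun m => k ≤ m.count a).card
      = ∑ p ∈ antidiagonal n, if k * w a = p.1 then (S p.2).card else 0 := by
    intro k a
    by_cases hle : k * w a ≤ n
    · rw [sum_eq_single (k * w a, n - k * w a)]
      · rw [if_pos rfl]
        refine card_bij' (fun m _ => m - Multiset.replicate k a)
          (fun m _ => m + Multiset.replicate k a) ?_ ?_ ?_ ?_
        · intro m hm
          rw [mem_filter, hS] at hm
          have h1 := Multiset.le_count_iff_replicate_le.1 hm.2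
          have h2 := multisetWeight_add (w := w) (m - Multiset.replicate k a)
            (Multiset.replicate k a)
          rw [Multiset.sub_add_cancel h1, multisetWeight_replicate] at h2
          rw [hS]
          omega
        · intro m hm
          rw [hS] at hm
          rw [mem_filter, hS, multisetWeight_add, multisetWeight_replicate, hm]
          refine ⟨by simp only; omega, ?_⟩
          simp
        · intro m hm
          exact Multiset.sub_add_cancel
            (Multiset.le_count_iff_replicate_le.1 (mem_filter.1 hm).2)
        · intro m _
          exact Multiset.add_sub_cancel_right
      · rintro ⟨i, j⟩ hij hne
        refine if_neg ?_
        rintro rfl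
        rw [HasAntidiagonal.mem_antidiagonal] at hij
        simp only at hij
        exact hne (Prod.ext rfl (by simp only; omega))
      · intro h
        exact absurd (HasAntidiagonal.mem_antidiagonal.2 (by simp only; omega)) h
    · rw [sum_eq_zero, card_eq_zero, filter_eq_empty_iff]
      · intro m hm hk
        rw [hS] at hm
        have h1 := Multiset.le_count_iff_replicate_le.1 hk
        have h2 := multisetWeight_add (w := w) (m - Multiset.replicate k a)
          (Multiset.replicate k a)
        rw [Multiset.sub_add_cancel h1, multisetWeight_replicate] at h2
        omega
      · rintro ⟨i, j⟩ hij
        rw [HasAntidiagonal.mem_antidiagonal] at hij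
        exact if_neg (by simp only at hij ⊢; omega)
  -- The weight of `m`, with each multiplicity written as the number of `k ≥ 1` not exceeding it; `k
  -- ≤ n` suffices as weights are positive. Summing over `m` and exchanging sums gives the
  -- recursion.
  have hsum : ∀ m ∈ S n, n = ∑ k ∈ Icc 1 n, ∑ a ∈ U, if k ≤ m.count a then w a else 0 := by
    intro m hm
    rw [hS] at hm
    rw [sum_comm]
    have h1 : ∀ a ∈ U, (∑ k ∈ Icc 1 n, if k ≤ m.count a then w a else 0) = m.count a * w a := by
      intro a _
      rw [← sum_filter, sum_const, smul_eq_mul]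
      congr 1
      have hle : m.count a ≤ n :=
        (Multiset.count_le_card a m).trans (hm ▸ card_le_multisetWeight hw m)
      have : (Icc 1 n).filter (fun k => k ≤ m.count a) = Icc 1 (m.count a) := by
        ext k
        simp only [mem_filter, mem_Icc]
        omega
      rw [this, Nat.card_Icc, Nat.add_sub_cancel]
    rw [sum_congr rfl h1]
    conv_lhs => rw [← hm, multisetWeight, sum_multiset_map_count]
    refine sum_subset (fun a ha => ?_) fun a _ ha => ?_
    · rw [hU, ← hm]
      exact le_multisetWeight (Multiset.mem_toFinset.1 ha)
    · rw [Multiset.mem_toFinset] at ha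
      rw [Multiset.count_eq_zero_of_notMem ha, zero_smul]
  simp only [hScard]
  rw [mul_comm, ← smul_eq_mul, ← sum_const, sum_congr rfl hsum, sum_comm]
  have hL : ∀ k ∈ Icc 1 n, (∑ m ∈ S n, ∑ a ∈ U, if k ≤ m.count a then w a else 0)
      = ∑ p ∈ antidiagonal n, ∑ a ∈ U, (if k * w a = p.1 then w a else 0) * (S p.2).card := by
    intro k _
    rw [sum_comm, sum_comm (s := antidiagonal n)]
    refine sum_congr rfl fun a _ => ?_
    rw [← sum_filter, sum_const, smul_eq_mul, hcount, sum_mul]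
    refine sum_congr rfl fun p _ => ?_
    split_ifs
    · exact mul_comm _ _
    · simp
  rw [sum_congr rfl hL, sum_comm]
  refine sum_congr rfl fun p hp => ?_
  rw [hc p.1 (Nat.le.intro (HasAntidiagonal.mem_antidiagonal.1 hp)), sum_mul]
  exact sum_congr rfl fun k _ => (sum_mul _ _ _).symm

theorem card_multiset_card_eq_one (n : ℕ) :
    Nat.card {m // multisetWeight w m = n ∧ m.card = 1} = Nat.card {a // w a = n} := by
  refine (Nat.card_congr (Equiv.ofBijective
    (fun a => ⟨{a.1}, by simp [multisetWeight, a.2], by simp⟩) ⟨?_, ?_⟩)).symm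
  · intro a b h
    exact Subtype.ext (by simpa using h)
  · rintro ⟨m, hm, hc⟩
    obtain ⟨a, rfl⟩ := Multiset.card_eq_one.1 hc
    exact ⟨⟨a, by simpa [multisetWeight] using hm⟩, rfl⟩

theorem finite_weight_add_eq (hfin : ∀ n, {a | w a = n}.Finite) (n : ℕ) :
    {p : α × α | w p.1 + w p.2 = n}.Finite := by
  refine ((finite_weight_le hfin n).prod (finite_weight_le hfin n)).subset fun p hp => ?_
  have hp : w p.1 + w p.2 = n := hp
  exact ⟨show w p.1 ≤ n by omega, show w p.2 ≤ n by omega⟩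

/-- Multisets with two elements are counted by ordered pairs and by elements taken twice. -/
theorem two_mul_card_multiset_card_eq_two (hfin : ∀ n, {a | w a = n}.Finite) (n : ℕ) :
    2 * Nat.card {m // multisetWeight w m = n ∧ m.card = 2}
      = Nat.card {p : α × α // w p.1 + w p.2 = n} + Nat.card {a // 2 * w a = n} := by
  classical
  -- An arbitrary linear order lets each two-element multiset be represented by one sorted pair.
  let _ : LinearOrder α := linearOrderOfSTO WellOrderingRel
  let P := (finite_weight_add_eq hfin n).toFinset
  have hP : ∀ p, p ∈ P ↔ w p.1 + w p.2 = n := fun p => by simp [P]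
  have h1 : Nat.card {m // multisetWeight w m = n ∧ m.card = 2}
      = (P.filter fun p => p.1 ≤ p.2).card := by
    rw [← Nat.card_eq_finsetCard]
    refine (Nat.card_congr (Equiv.ofBijective (fun p => ⟨{p.1.1, p.1.2},
      by simpa [multisetWeight] using (hP _).1 (Finset.mem_filter.1 p.2).1, by simp⟩)
      ⟨?_, ?_⟩)).symm
    · rintro ⟨⟨a, b⟩, hp⟩ ⟨⟨c, d⟩, hq⟩ h
      have hp := (Finset.mem_filter.1 hp).2
      have hq := (Finset.mem_filter.1 hq).2
      have h : (a = c ∧ b = d) ∨ (a = d ∧ b = c) := by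
        have h := congrArg Subtype.val h
        change ((([a, b] : List α) : Multiset α)) = ([c, d] : List α) at h
        simpa using List.perm_pair.1 (Multiset.coe_eq_coe.1 h)
      simp only at hp hq
      refine Subtype.ext (Prod.ext_iff.2 ?_)
      rcases h with h | ⟨rfl, rfl⟩
      · exact h
      · have := le_antisymm hp hq
        exact ⟨this, this.symm⟩
    · rintro ⟨m, hm, hc⟩
      obtain ⟨a, b, rfl⟩ := Multiset.card_eq_two.1 hc
      have hab : w a + w b = n := by simpa [multisetWeight] using hm
      rcases le_total a b with h | h
      · exact ⟨⟨(a, b), Finset.mem_filter.2 ⟨(hP _).2 hab, h⟩⟩, rfl⟩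
      · refine ⟨⟨(b, a), Finset.mem_filter.2 ⟨(hP _).2 (by simp only; omega), h⟩⟩, ?_⟩
        exact Subtype.ext (Multiset.pair_comm b a)
  have h2 : Nat.card {p : α × α // w p.1 + w p.2 = n} = P.card := by
    rw [← Nat.card_eq_finsetCard]
    exact Nat.card_congr (Equiv.subtypeEquivRight fun p => (hP p).symm)
  have h3 : Nat.card {a // 2 * w a = n} = (P.filter fun p => p.1 = p.2).card := by
    rw [← Nat.card_eq_finsetCard]
    refine Nat.card_congr (Equiv.ofBijective (fun a => ⟨(a.1, a.1), Finset.mem_filter.2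
      ⟨(hP _).2 (by simpa [two_mul] using a.2), rfl⟩⟩) ⟨?_, ?_⟩)
    · intro a b h
      exact Subtype.ext (congrArg (fun z => z.1.1) h)
    · rintro ⟨⟨a, b⟩, hp⟩
      obtain ⟨hp, (rfl : a = b)⟩ := Finset.mem_filter.1 hp
      exact ⟨⟨a, by simpa [two_mul] using (hP _).1 hp⟩, rfl⟩
  have h4 : (P.filter fun p => ¬ p.1 ≤ p.2).card = (P.filter fun p => p.1 < p.2).card := by
    refine Finset.card_bij' (fun p _ => p.swap) (fun p _ => p.swap) ?_ ?_ ?_ ?_ <;>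
      simp +contextual [hP, add_comm]
  have h5 := Finset.card_filter_add_card_filter_not (s := P) (fun p => p.1 ≤ p.2)
  have h6 : (P.filter fun p => p.1 ≤ p.2).card
      = (P.filter fun p => p.1 < p.2).card + (P.filter fun p => p.1 = p.2).card := by
    rw [← Finset.card_union_of_disjoint]
    · congr 1
      ext p
      simp only [Finset.mem_filter, Finset.mem_union, le_iff_lt_or_eq]
      tauto
    · rw [Finset.disjoint_filter]
      exact fun p _ h => h.ne
  omega

theorem card_weight_add_eq (hfin : ∀ n, {a | w a = n}.Finite) (n : ℕ) :
    Nat.card {p : α × α // w p.1 + w p.2 = n} = ∑ p ∈ Finset.HasAntidiagonal.antidiagonal n,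
      Nat.card {a // w a = p.1} * Nat.card {a // w a = p.2} := by
  classical
  have hf : ∀ i, Finite {a // w a = i} := hfin
  simp only [← Nat.card_prod]
  rw [← Finset.sum_coe_sort, ← Nat.card_sigma]
  exact Nat.card_congr
    { toFun := fun p => ⟨⟨(w p.1.1, w p.1.2), Finset.HasAntidiagonal.mem_antidiagonal.2 p.2⟩, ⟨p.1.1, rfl⟩, ⟨p.1.2, rfl⟩⟩
      invFun := fun z => ⟨(z.2.1.1, z.2.2.1), by
        rw [z.2.1.2, z.2.2.2]
        exact Finset.HasAntidiagonal.mem_antidiagonal.1 z.1.2⟩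
      left_inv := fun p => rfl
      right_inv := by
        rintro ⟨⟨⟨i, j⟩, h⟩, ⟨a, ha⟩, ⟨b, hb⟩⟩
        obtain rfl : w a = i := ha
        obtain rfl : w b = j := hb
        rfl }

theorem card_two_mul_weight_eq (n : ℕ) :
    Nat.card {a // 2 * w a = n} = if 2 ∣ n then Nat.card {a // w a = n / 2} else 0 := by
  split_ifs with h
  · exact Nat.card_congr (Equiv.subtypeEquivRight fun a => by omega)
  · have : IsEmpty {a // 2 * w a = n} := ⟨fun a => h ⟨_, a.2.symm⟩⟩
    exact Nat.card_of_isEmpty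

end Weighted

/-! ### Formal exponential and Euler transform -/

theorem coeff_expTerm (f : ℚ⟦X⟧) (k : ℕ+) (n : ℕ) :
    coeff n (expTerm f k) = 1 / (k : ℚ) * if (k : ℕ) ∣ n then coeff (n / k) f else 0 := by
  rw [expTerm, PowerSeries.coeff_smul, coeff_expand, smul_eq_mul]

/-- Only the divisors `k` of `n` contribute to the coefficient at `n`. At `n = 0` every `k` divides,
and the vanishing constant term makes all terms zero, in accordance with `Nat.divisors 0 = ∅`. -/
theorem hasSum_expTerm {f : ℚ⟦X⟧} (hf : coeff 0 f = 0) :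
    HasSum (expTerm f)
      (PowerSeries.mk fun n => ∑ k ∈ n.divisors, 1 / (k : ℚ) * coeff (n / k) f) := by
  rw [WithPiTopology.hasSum_iff_hasSum_coeff]
  intro n
  simp only [coeff_expTerm, coeff_mk]
  let F : ℕ → ℚ := fun k => 1 / (k : ℚ) * if k ∣ n then coeff (n / k) f else 0
  have h1 : HasSum F (∑ k ∈ n.divisors, F k) := by
    refine hasSum_sum_of_ne_finset_zero fun k hk => ?_
    rw [Nat.mem_divisors, not_and_or, not_not] at hk
    rcases hk with hk | rfl
    · simp [F, hk]
    · simp [F, hf]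
  have h2 : ∑ k ∈ n.divisors, F k = ∑ k ∈ n.divisors, 1 / (k : ℚ) * coeff (n / k) f := by
    refine Finset.sum_congr rfl fun k hk => ?_
    simp [F, Nat.dvd_of_mem_divisors hk]
  rw [h2] at h1
  refine (PNat.coe_injective.hasSum_iff (f := F) fun k hk => ?_).2 h1
  obtain rfl : k = 0 := by
    by_contra h
    exact hk ⟨⟨k, Nat.pos_of_ne_zero h⟩, rfl⟩
  -- The sum over `ℕ` has the extra index `0`, where `1 / 0 = 0`.
  simp [F]

theorem tsum_expTerm {f : ℚ⟦X⟧} (hf : coeff 0 f = 0) : ∑' k, expTerm f k =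
    PowerSeries.mk fun n => ∑ k ∈ n.divisors, 1 / (k : ℚ) * coeff (n / k) f :=
  (hasSum_expTerm hf).tsum_eq

theorem constantCoeff_tsum_expTerm {f : ℚ⟦X⟧} (hf : coeff 0 f = 0) :
    constantCoeff (∑' k, expTerm f k) = 0 := by
  rw [tsum_expTerm hf, ← coeff_zero_eq_constantCoeff_apply, coeff_mk]
  simp

theorem PowerSeries.constantCoeff_exp_subst {g : ℚ⟦X⟧} (hg : constantCoeff g = 0) :
    coeff 0 ((exp ℚ).subst g) = 1 := by
  rw [coeff_subst' (HasSubst.of_constantCoeff_zero' hg), finsum_eq_single _ 0]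
  · simp
  · intro d hd
    simp [hg, hd]

/-- The recursion for the coefficients of the exponential of a power series. -/
theorem PowerSeries.succ_mul_coeff_exp_subst {g : ℚ⟦X⟧} (hg : constantCoeff g = 0) (n : ℕ) :
    ((n + 1 : ℕ) : ℚ) * coeff (n + 1) ((exp ℚ).subst g) =
      ∑ p ∈ Finset.HasAntidiagonal.antidiagonal n,
        (((p.1 + 1 : ℕ) : ℚ) * coeff (p.1 + 1) g) * coeff p.2 ((exp ℚ).subst g) := by
  have h := derivative_subst (f := exp ℚ) (HasSubst.of_constantCoeff_zero' hg)
  rw [derivative_exp, mul_comm] at h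
  have h := congrArg (coeff n) h
  rw [coeff_derivative, coeff_mul] at h
  rw [mul_comm, Nat.cast_add, Nat.cast_one, h]
  refine Finset.sum_congr rfl fun p _ => ?_
  rw [coeff_derivative]
  push_cast
  ring

section Weighted

variable {α : Type*} {w : α → ℕ}

theorem coeff_weightGF (n : ℕ) : coeff n (weightGF w) = Nat.card {a // w a = n} := coeff_mk _ _

theorem coeff_zero_weightGF (hw : ∀ a, 0 < w a) : coeff 0 (weightGF w) = 0 := by
  have : IsEmpty {a // w a = 0} := ⟨fun a => (hw a).ne' a.2⟩
  simp [coeff_weightGF]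

/-- Multisets of weighted objects are counted by the Euler transform. -/
theorem weightGF_multisetWeight (hw : ∀ a, 0 < w a) (hfin : ∀ n, {a | w a = n}.Finite) :
    weightGF (multisetWeight w) = (exp ℚ).subst (∑' k, expTerm (weightGF w) k) := by
  have hf := coeff_zero_weightGF hw
  have hg := constantCoeff_tsum_expTerm hf
  ext n
  induction n using Nat.strong_induction_on with
  | _ n ih =>
    rcases n with _ | n
    · rw [PowerSeries.constantCoeff_exp_subst hg, coeff_weightGF]
      have : Nat.card {m // multisetWeight w m = 0} = 1 := by
        rw [Nat.card_eq_one_iff_unique]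
        refine ⟨⟨fun a b => Subtype.ext ?_⟩, ⟨0, rfl⟩⟩
        have h : ∀ m, multisetWeight w m = 0 → m = 0 := fun m hm =>
          Multiset.card_eq_zero.1 (Nat.le_zero.1 (hm ▸ card_le_multisetWeight hw m))
        rw [h _ a.2, h _ b.2]
      rw [this, Nat.cast_one]
    · have hn : ((n + 1 : ℕ) : ℚ) ≠ 0 := Nat.cast_ne_zero.2 n.succ_ne_zero
      refine mul_left_cancel₀ hn ?_
      -- Both sides obey one recursion: the counting of multisets on the left, `(exp g)' = g' * exp
      -- g` on the right. The summand at `p.1 = 0` drops out because `0` has no divisors in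
      -- `Nat.divisors`.
      rw [PowerSeries.succ_mul_coeff_exp_subst hg, coeff_weightGF, ← Nat.cast_mul,
        mul_card_multisetWeight_eq hw hfin, Finset.Nat.sum_antidiagonal_succ]
      simp only [Nat.divisors_zero, Finset.sum_empty, zero_mul, zero_add, Nat.cast_sum,
        Nat.cast_mul]
      refine Finset.sum_congr rfl fun p hp => ?_
      have hp : p.1 + p.2 = n := Finset.HasAntidiagonal.mem_antidiagonal.1 hp
      rw [← ih p.2 (by omega), coeff_weightGF, tsum_expTerm hf, coeff_mk, Finset.mul_sum]
      congr 1
      refine Finset.sum_congr rfl fun k hk => ?_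
      have hk0 : (k : ℚ) ≠ 0 := Nat.cast_ne_zero.2 (Nat.pos_of_mem_divisors hk).ne'
      rw [Nat.cast_div (Nat.dvd_of_mem_divisors hk) hk0, coeff_weightGF]
      ring

theorem coeff_weightGF_sq (hfin : ∀ n, {a | w a = n}.Finite) (n : ℕ) :
    coeff (R := ℚ) n (weightGF w ^ 2) = Nat.card {p : α × α // w p.1 + w p.2 = n} := by
  rw [card_weight_add_eq hfin, sq, coeff_mul]
  simp [coeff_weightGF]

theorem coeff_expand_two_weightGF (n : ℕ) :
    coeff n (expand 2 two_ne_zero (weightGF w)) = Nat.card {a // 2 * w a = n} := by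
  rw [card_two_mul_weight_eq, coeff_expand]
  split_ifs
  · rw [coeff_weightGF]
  · simp

/-- Multisets with a number of elements different from `k`, together with an additional root. -/
theorem card_multisetWeight_add_one (hw : ∀ a, 0 < w a) (hfin : ∀ n, {a | w a = n}.Finite)
    (k : ℕ) :
    (PowerSeries.mk fun n => (Nat.card {m // multisetWeight w m + 1 = n ∧ m.card ≠ k} : ℚ))
      = X * (weightGF (multisetWeight w) - PowerSeries.mk fun n =>
        (Nat.card {m // multisetWeight w m = n ∧ m.card = k} : ℚ)) := by
  ext n
  rcases n with _ | n
  · rw [coeff_mk, coeff_zero_X_mul]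
    have : IsEmpty {m // multisetWeight w m + 1 = 0 ∧ m.card ≠ k} :=
      ⟨fun m => Nat.succ_ne_zero _ m.2.1⟩
    simp
  · rw [coeff_succ_X_mul, map_sub, coeff_mk, coeff_mk, coeff_weightGF, eq_sub_iff_add_eq]
    have hS := finite_multisetWeight_eq hw hfin n
    have h1 : Nat.card {m // multisetWeight w m + 1 = n + 1 ∧ m.card ≠ k}
        = ({m | multisetWeight w m = n} \ {m | m.card = k}).ncard := by
      rw [← Nat.card_coe_set_eq]
      exact Nat.card_congr (Equiv.subtypeEquivRight fun m => by
        simp only [Nat.add_right_cancel_iff]; rfl)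
    have h2 : Nat.card {m // multisetWeight w m = n ∧ m.card = k}
        = ({m | multisetWeight w m = n} ∩ {m | m.card = k}).ncard := rfl
    have h3 : Nat.card {m // multisetWeight w m = n} = {m | multisetWeight w m = n}.ncard := rfl
    rw [h1, h2, h3, ← Set.ncard_inter_add_ncard_sdiff_eq_ncard _ {m | m.card = k} hS]
    push_cast
    ring

end Weighted

/-! ### Assembling the functional equations -/

instance (n : ℕ) : Finite (STree n) := inferInstanceAs (Finite (Subtype _))

theorem STreeClass.card_size_eq (n : ℕ) :
    Nat.card {a : STreeClass // a.size = n} = Nat.card (Quotient (STree.isoSetoid n)) :=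
  Nat.card_congr (Equiv.sigmaSubtype n)

theorem STreeClass.finite_size_eq (n : ℕ) : {a : STreeClass | a.size = n}.Finite :=
  Finite.of_equiv _ (Equiv.sigmaSubtype n).symm

theorem sTreeGF_eq_weightGF : sTreeGF = weightGF STreeClass.size := by
  ext n
  rw [coeff_weightGF, STreeClass.card_size_eq, sTreeGF, coeff_mk]

/-- The excluded multisets of size 1 are single `S`-trees, hence the subtracted series is `sTreeGF`
itself. -/
theorem sTreeGF_eq : sTreeGF = X * (weightGF (multisetWeight STreeClass.size) - sTreeGF) := by
  have h := card_multisetWeight_add_one STreeClass.size_pos STreeClass.finite_size_eq 1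
  simp only [card_multiset_card_eq_one] at h
  conv_lhs => rw [sTreeGF]
  simp only [STree.card_quotient]
  refine h.trans ?_
  rw [sTreeGF_eq_weightGF]
  rfl

theorem two_mul_hiTreeGF_add : 2 * hiTreeGF + sTreeGF ^ 2
    = 2 * (PowerSeries.mk fun n => (Nat.card {m : Multiset STreeClass //
        multisetWeight STreeClass.size m + 1 = n ∧ m.card ≠ 2} : ℚ))
      + expand 2 two_ne_zero sTreeGF := by
  ext n
  rw [sTreeGF_eq_weightGF, two_mul, two_mul]
  simp only [map_add]
  rw [coeff_weightGF_sq STreeClass.finite_size_eq, coeff_expand_two_weightGF, hiTreeGF, coeff_mk,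
    coeff_mk, ← two_mul, ← two_mul]
  exact_mod_cast HITree.two_mul_card_quotient_add n

theorem two_mul_card_pairs : 2 * (PowerSeries.mk fun n => (Nat.card {m : Multiset STreeClass //
      multisetWeight STreeClass.size m = n ∧ m.card = 2} : ℚ))
    = sTreeGF ^ 2 + expand 2 two_ne_zero sTreeGF := by
  ext n
  rw [sTreeGF_eq_weightGF, two_mul]
  simp only [map_add]
  rw [coeff_weightGF_sq STreeClass.finite_size_eq, coeff_expand_two_weightGF, coeff_mk, ← two_mul]
  exact_mod_cast two_mul_card_multiset_card_eq_two STreeClass.finite_size_eq n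

/-- `expand k _ f` is `f(x ^ k)`, and `(exp ℚ).subst g` is the formal series `exp (g(x))`. The
infinite sum converges coefficientwise and has zero constant term, so that its exponential is
meaningful. -/
theorem mainTheorem1 :
    hiTreeGF =
        (1 + X) * sTreeGF
          + (C (1 / 2 : ℚ) : ℚ⟦X⟧) * (1 - X) * PowerSeries.expand 2 two_ne_zero sTreeGF
          - (C (1 / 2 : ℚ) : ℚ⟦X⟧) * (1 + X) * sTreeGF ^ 2
      ∧ Summable (expTerm sTreeGF)
      ∧ constantCoeff (∑' k : ℕ+, expTerm sTreeGF k) = 0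
      ∧ sTreeGF
          = X * ((PowerSeries.exp ℚ).subst (∑' k : ℕ+, expTerm sTreeGF k) - sTreeGF) := by
  have hf : coeff 0 sTreeGF = 0 := by
    rw [sTreeGF_eq_weightGF]
    exact coeff_zero_weightGF STreeClass.size_pos
  refine ⟨?_, (hasSum_expTerm hf).summable, constantCoeff_tsum_expTerm hf, ?_⟩
  · have h1 := two_mul_hiTreeGF_add
    have h2 := card_multisetWeight_add_one STreeClass.size_pos STreeClass.finite_size_eq 2
    have h3 := two_mul_card_pairs
    have h4 := sTreeGF_eq
    have hC : (C (1 / 2 : ℚ) : ℚ⟦X⟧) * 2 = 1 := by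
      rw [show (2 : ℚ⟦X⟧) = C (2 : ℚ) from (map_ofNat C 2).symm, ← map_mul]
      norm_num
    rw [h2] at h1
    -- Half of `h1`, with the two-element multisets eliminated by `h3` and the multiset series by
    -- `h4`; the `hC` term cancels `C (1 / 2)` against 2.
    linear_combination (C (1 / 2 : ℚ) : ℚ⟦X⟧) * h1 - (C (1 / 2 : ℚ) : ℚ⟦X⟧) * X * h3 - h4
      + (X * weightGF (multisetWeight STreeClass.size) - hiTreeGF) * hC
  · conv_lhs => rw [sTreeGF_eq]
    rw [weightGF_multisetWeight STreeClass.size_pos STreeClass.finite_size_eq,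
      ← sTreeGF_eq_weightGF]
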